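/- Let $S^1=\mathbb R/2\pi\mathbb Z$, let $H^1(S^1)$ be the space of real functions $f\in L^2(S^1)$ with weak derivative $f_x\in L^2(S^1)$, normed by $\|f\|_{H^1}^2=\|f\|_{L^2}^2+\|f_x\|_{L^2}^2$, and let $$Hf(x)=\frac1{2\pi}\,\mathrm{P.V.}\int_{-\pi}^{\pi} f(y)\cot\Big(\frac{x-y}2\Big)\,dy$$ be the periodic Hilbert transform. Consider the system $$\Omega_t+m\,\Omega_x=0,\qquad \omega_t+p\,\omega_x=0,\qquad p_x=H\Omega,\qquad m_x=H\omega \qquad (x\in S^1),$$ where $p$ and $m$ are normalised by $\int_{-\pi}^{\pi}p(t,x)\,dx=\int_{-\pi}^{\pi}m(t,x)\,dx=0$. **Theorem.** For all $\Omega_0,\omega_0\in H^1(S^1)$ there exists a unique solution $(\Omega,\omega)$ of this system on $[0,\infty)$ with $\Omega(0)=\Omega_0$, $\omega(0)=\omega_0$ and $$\Omega,\ \omega\in C^0\big([0,\infty);H^1(S^1)\big)\cap C^1\big([0,\infty);L^2(S^1)\big),$$ the two evolution equations being equalities in $L^2(S^1)$ for every $t\ge 0$. -/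

import Mathlib

open Real Set Filter Topology MeasureTheory

noncomputable section

/-- The circle `S¹ = ℝ / 2πℤ`, i.e. the periodic interval `[-π, π]`; its volume has total mass `2π`. -/
abbrev S1 : Type := AddCircle (2 * π)

instance fact_two_pi_pos : Fact (0 < 2 * π) := ⟨Real.two_pi_pos⟩

/-- The real Hilbert space `L²(S¹)`. -/
abbrev L2S1 : Type := Lp ℝ 2 (volume : Measure S1)

/-- `φ` is a smooth (periodic) test function on the circle with derivative `ψ`. -/
structure IsTestPair (φ ψ : S1 → ℝ) : Prop where
  smooth : ContDiff ℝ (⊤ : ℕ∞) (fun s : ℝ => φ (s : S1))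
  deriv : ∀ s : ℝ, HasDerivAt (fun r : ℝ => φ (r : S1)) (ψ (s : S1)) s

/-- `g` is the weak derivative of `f` on the circle. -/
def IsWeakDeriv (f g : L2S1) : Prop :=
  ∀ φ ψ : S1 → ℝ, IsTestPair φ ψ → ∫ x, f x * ψ x = -∫ x, g x * φ x

theorem continuous_of_lift {φ : S1 → ℝ} (h : Continuous fun s : ℝ => φ (s : S1)) :
    Continuous φ :=
  (QuotientAddGroup.isQuotientMap_mk (N := AddSubgroup.zmultiples (2 * π))).continuous_iff.2 h

theorem IsTestPair.continuous_fst {φ ψ : S1 → ℝ} (h : IsTestPair φ ψ) : Continuous φ :=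
  continuous_of_lift h.smooth.continuous

theorem IsTestPair.continuous_snd {φ ψ : S1 → ℝ} (h : IsTestPair φ ψ) : Continuous ψ := by
  apply continuous_of_lift
  have h1 : (fun s : ℝ => ψ (s : S1)) = _root_.deriv (fun r : ℝ => φ (r : S1)) :=
    funext fun s => (h.deriv s).deriv.symm
  rw [h1]
  exact h.smooth.continuous_deriv (by simp)

theorem integrable_L2S1_mul (f : L2S1) {φ : S1 → ℝ} (h : Continuous φ) :
    Integrable (fun x => f x * φ x) := by
  have h1 : Integrable f (volume : Measure S1) :=
    (Lp.memLp f).integrable (by norm_num)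
  have h2 : BddAbove (range fun x => ‖φ x‖) := (isCompact_range h.norm).bddAbove
  obtain ⟨C, hC⟩ := h2
  exact h1.mul_bdd (c := C) h.aestronglyMeasurable
    (Eventually.of_forall fun x => hC ⟨x, rfl⟩)

/-- The Sobolev space `H¹(S¹)`, realised as the space of pairs `(f, f')` of an `L²` function and
its weak derivative in `L²`, with the norm `‖f‖² = ‖f‖²_{L²} + ‖f'‖²_{L²}`. -/
def H1Submodule : Submodule ℝ (WithLp 2 (L2S1 × L2S1)) where
  carrier := {u | IsWeakDeriv u.fst u.snd}
  zero_mem' := by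
    intro φ ψ _
    have h0 : ((0 : L2S1) : S1 → ℝ) =ᵐ[volume] 0 := Lp.coeFn_zero _ _ _
    have h (θ : S1 → ℝ) : ∫ x, (0 : L2S1) x * θ x = 0 := by
      rw [integral_congr_ae (g := fun _ => (0 : ℝ))]
      · simp
      · filter_upwards [h0] with x hx
        rw [hx, Pi.zero_apply, zero_mul]
    change ∫ x, (0 : L2S1) x * ψ x = -∫ x, (0 : L2S1) x * φ x
    rw [h, h, neg_zero]
  add_mem' := by
    intro u v hu hv φ ψ hφ
    have h (a b : L2S1) (θ : S1 → ℝ) (hθ : Continuous θ) :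
        ∫ x, (a + b : L2S1) x * θ x = (∫ x, a x * θ x) + ∫ x, b x * θ x := by
      rw [← integral_add (integrable_L2S1_mul a hθ) (integrable_L2S1_mul b hθ)]
      refine integral_congr_ae ?_
      filter_upwards [Lp.coeFn_add a b] with x hx
      rw [hx, Pi.add_apply, add_mul]
    change ∫ x, (u.fst + v.fst : L2S1) x * ψ x = -∫ x, (u.snd + v.snd : L2S1) x * φ x
    rw [h _ _ _ hφ.continuous_snd, h _ _ _ hφ.continuous_fst, hu φ ψ hφ, hv φ ψ hφ, neg_add]
  smul_mem' := by
    intro c u hu φ ψ hφ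
    have h (a : L2S1) (θ : S1 → ℝ) :
        ∫ x, (c • a : L2S1) x * θ x = c * ∫ x, a x * θ x := by
      rw [← integral_const_mul]
      refine integral_congr_ae ?_
      filter_upwards [Lp.coeFn_smul c a] with x hx
      rw [hx, Pi.smul_apply, smul_eq_mul, mul_assoc]
    change ∫ x, (c • u.fst : L2S1) x * ψ x = -∫ x, (c • u.snd : L2S1) x * φ x
    rw [h, h, hu φ ψ hφ, mul_neg]

/-- The Hilbert space `H¹(S¹)`. -/
abbrev H1S1 : Type := H1Submodule

/-- The underlying `L²` function of an element of `H¹(S¹)`. -/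
def H1S1.fn (u : H1S1) : L2S1 := u.1.fst

/-- The weak derivative `f_x ∈ L²(S¹)` of an element `f` of `H¹(S¹)`. -/
def H1S1.dx (u : H1S1) : L2S1 := u.1.snd

theorem periodic_cot_half : Function.Periodic (fun s : ℝ => Real.cot (s / 2)) (2 * π) := by
  intro s
  have h : (s + 2 * π) / 2 = s / 2 + π := by ring
  simp only [h, Real.cot_eq_cos_div_sin, Real.cos_add_pi, Real.sin_add_pi, neg_div_neg_eq]

/-- The function `s ↦ cot (s / 2)` on the circle. -/
def cotHalf : S1 → ℝ := periodic_cot_half.lift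

/-- The Hilbert transform of `f` exists at `x` and equals `h`:
`h = (1 / 2π) P.V. ∫ f(y) cot ((x - y) / 2) dy`. -/
def HasHilbertTransformAt (f : S1 → ℝ) (x : S1) (h : ℝ) : Prop :=
  Tendsto (fun ε : ℝ => 1 / (2 * π) * ∫ y in {y : S1 | ε < dist x y}, f y * cotHalf (x - y))
    (𝓝[>] 0) (𝓝 h)

/-- `p` is the velocity determined by `w`: `p_x = H w` (almost everywhere), normalised to have
zero mean. -/
def IsVelocityOf (p w : H1S1) : Prop :=
  (∀ᵐ x : S1, HasHilbertTransformAt w.fn x (p.dx x)) ∧ ∫ x, p.fn x = 0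

/-- `(Ω, ω)`, as functions of time `t ∈ [0, ∞)`, is a solution on `[0, ∞)` of
`Ω_t + m Ω_x = 0`, `ω_t + p ω_x = 0`, `p_x = H Ω`, `m_x = H ω` with initial data `(Ω₀, ω₀)`, in the
class `C⁰([0, ∞); H¹(S¹)) ∩ C¹([0, ∞); L²(S¹))`. Only the values at times `t ≥ 0` matter. -/
structure IsGlobalSolution (Ω₀ ω₀ : H1S1) (Ω ω : ℝ → H1S1) : Prop where
  continuousOn_Ω : ContinuousOn Ω (Ici 0)
  continuousOn_ω : ContinuousOn ω (Ici 0)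
  contDiffOn_Ω : ContDiffOn ℝ 1 (fun t => (Ω t).fn) (Ici 0)
  contDiffOn_ω : ContDiffOn ℝ 1 (fun t => (ω t).fn) (Ici 0)
  initial_Ω : Ω 0 = Ω₀
  initial_ω : ω 0 = ω₀
  equations : ∀ t ∈ Ici (0 : ℝ), ∃ p m : H1S1, IsVelocityOf p (Ω t) ∧ IsVelocityOf m (ω t) ∧
    (∀ᵐ x : S1, derivWithin (fun τ => (Ω τ).fn) (Ici 0) t x + m.fn x * (Ω t).dx x = 0) ∧
    (∀ᵐ x : S1, derivWithin (fun τ => (ω τ).fn) (Ici 0) t x + p.fn x * (ω t).dx x = 0)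

end

/-! Integrating the cotangent by parts turns the Hilbert transform of an `H¹` function into a
convolution with a logarithm: `H f = K * f_x`, where `K` is `π⁻¹ log |sin (z/2)|` up to a constant
(`hasHilbertTransformAt_of_isPrimitive`). Hence `p = K₁ * Ω_x` and `m = K₁ * ω_x` with `K₁' = K`.
Differentiating the equations, `Ω_x` is a density carried by the flow `X` of `m`, and `ω_x` one
carried by the flow `Y` of `p`. Therefore `p(t,x) = ∫ K₁(x - X(t,b)) Ω₀'(b) db`, and likewise for
`m` with `Y` and `ω₀'`: the system closes into an ODE for the displacements of `X` and `Y` in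
`C(S¹)²`.

This ODE is global for two reasons. If the slopes of a circle map are at least `exp (-M)`, the
generated velocity depends on the map in a Lipschitz way and has space derivative at most `‖g‖₁ M +
const` (`abs_velocity_sub_le`, `abs_velocityDeriv_le`), because a logarithmic singularity converts a
factor `exp (-M)` into a summand `M`. Such a derivative in turn controls the slopes of the flow, so
`M` obeys the linear equation `M' = A M + B` and stays finite. To apply Picard–Lindelöf with global
bounds, the generating maps are first retracted onto those with slopes at least `exp (-M(t))`; the
resulting flows satisfy that bound themselves (`isFlow_of_retract`), so the retraction was inactive.
Composing the initial data with the inverse flows gives the solution (`transport_fn_sub_eq`,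
`IsFlow.isVelocityOf`).

Uniqueness is an `L²` energy estimate. Moving the derivative onto the kernel gives `p = K * Ω` and
`m = K * ω`, and since `K ∈ L²`, both `|m - m'|` and `|m_x|` are bounded by Cauchy–Schwarz. The
difference of two solutions then satisfies a Gronwall inequality (`inner_sub_le_of_transport`,
`isGlobalSolution_unique`). -/

noncomputable section

/-! ### Primitives on the circle and integration by parts -/

/-- `F` is a primitive of `g` on the circle: increments of `F` are integrals of `g`. -/
def IsPrimitive (F g : S1 → ℝ) : Prop :=
  ∀ x y : ℝ, F (y : S1) - F (x : S1) = ∫ s in x..y, g (s : S1)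

theorem integral_S1 (f : S1 → ℝ) (t : ℝ) : ∫ x, f x = ∫ s in t..t + 2 * π, f (s : S1) :=
  (AddCircle.intervalIntegral_preimage (2 * π) t f).symm

theorem periodic_lift (g : S1 → ℝ) : Function.Periodic (fun s : ℝ => g (s : S1)) (2 * π) := by
  intro s
  simp only [AddCircle.coe_add_period]

theorem intervalIntegrable_lift {g : S1 → ℝ} (hg : Integrable g) (x y : ℝ) :
    IntervalIntegrable (fun s : ℝ => g (s : S1)) volume x y := by
  refine (periodic_lift g).intervalIntegrable (t := 0) (by positivity) ?_ x y
  rw [intervalIntegrable_iff_integrableOn_Ioc_of_le (by linarith [two_pi_pos])]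
  exact (AddCircle.measurePreserving_mk (2 * π) 0).integrable_comp_of_integrable hg

theorem ae_lift {p : S1 → Prop} (h : ∀ᵐ x, p x) : ∀ᵐ s : ℝ, p (s : S1) := by
  have h1 (n : ℤ) : ∀ᵐ s : ℝ, s ∈ Ioc (n • (2 * π)) (n • (2 * π) + 2 * π) → p (s : S1) :=
    (ae_restrict_iff' measurableSet_Ioc).1
      ((AddCircle.measurePreserving_mk (2 * π) _).quasiMeasurePreserving.ae h)
  filter_upwards [ae_all_iff.2 h1] with s hs
  obtain ⟨n, hn, -⟩ := existsUnique_add_zsmul_mem_Ioc two_pi_pos s 0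
  have := hs (-n)
  apply this
  simp only [zsmul_eq_mul, mem_Ioc, Int.cast_neg] at hn ⊢
  constructor <;> linarith [hn.1, hn.2]

theorem IsPrimitive.congr_ae {F g g' : S1 → ℝ} (h : IsPrimitive F g) (hg : g =ᵐ[volume] g') :
    IsPrimitive F g' := by
  intro x y
  rw [h x y]
  refine intervalIntegral.integral_congr_ae ?_
  filter_upwards [ae_lift hg] with s hs _
  exact hs

theorem IsPrimitive.lift_eq {F g : S1 → ℝ} (h : IsPrimitive F g) (x : ℝ) :
    (fun s : ℝ => F (s : S1)) = fun s : ℝ => F (x : S1) + ∫ r in x..s, g (r : S1) := by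
  funext s
  rw [← h x s]; ring

theorem IsPrimitive.continuous {F g : S1 → ℝ} (h : IsPrimitive F g) (hg : Integrable g) :
    Continuous F := by
  apply continuous_of_lift
  rw [h.lift_eq 0]
  exact continuous_const.add
    (intervalIntegral.continuous_primitive (intervalIntegrable_lift hg) 0)

theorem IsPrimitive.integral_eq_zero {F g : S1 → ℝ} (h : IsPrimitive F g) : ∫ x, g x = 0 := by
  rw [integral_S1 g 0, ← h, AddCircle.coe_add_period, sub_self]

theorem integrable_mul_continuous {f φ : S1 → ℝ} (hf : Integrable f) (hφ : Continuous φ) :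
    Integrable (fun x => f x * φ x) := by
  obtain ⟨C, hC⟩ : BddAbove (range fun x => ‖φ x‖) := (isCompact_range hφ.norm).bddAbove
  exact hf.mul_bdd (c := C) hφ.aestronglyMeasurable (Eventually.of_forall fun x => hC ⟨x, rfl⟩)

theorem integrable_continuous_mul {f φ : S1 → ℝ} (hf : Integrable f) (hφ : Continuous φ) :
    Integrable (fun x => φ x * f x) := by
  simpa only [mul_comm] using integrable_mul_continuous hf hφ

theorem IsPrimitive.absolutelyContinuousOnInterval {F g : S1 → ℝ} (h : IsPrimitive F g)
    (hg : Integrable g) (x y : ℝ) :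
    AbsolutelyContinuousOnInterval (fun s : ℝ => F (s : S1)) x y := by
  rw [h.lift_eq x]
  exact AbsolutelyContinuousOnInterval.add
    (contDiffOn_const (n := 1)).absolutelyContinuousOnInterval
    ((intervalIntegrable_lift hg x y).absolutelyContinuousOnInterval_intervalIntegral
      (c := x) (by simp))

theorem IsPrimitive.ae_hasDerivAt {F g : S1 → ℝ} (h : IsPrimitive F g) (hg : Integrable g)
    (x y : ℝ) :
    ∀ᵐ s : ℝ, s ∈ uIcc x y → HasDerivAt (fun s : ℝ => F (s : S1)) (g (s : S1)) s := by
  filter_upwards [(intervalIntegrable_lift hg x y).ae_hasDerivAt_integral] with s hs hsx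
  rw [h.lift_eq x]
  exact (hs hsx x (by simp)).const_add _

/-- Lifts of primitives are absolutely continuous, so the product rule is needed only almost
everywhere; this allows derivatives that are merely integrable. -/
theorem IsPrimitive.mul {F f G g : S1 → ℝ} (hF : IsPrimitive F f) (hG : IsPrimitive G g)
    (hf : Integrable f) (hg : Integrable g) :
    IsPrimitive (fun x => F x * G x) (fun x => f x * G x + F x * g x) := by
  intro x y
  rw [← AbsolutelyContinuousOnInterval.integral_deriv_mul_eq_sub
    (hF.absolutelyContinuousOnInterval hf x y) (hG.absolutelyContinuousOnInterval hg x y)]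
  refine intervalIntegral.integral_congr_ae ?_
  filter_upwards [hF.ae_hasDerivAt hf x y, hG.ae_hasDerivAt hg x y] with s h1 h2 hs
  have hs' := uIoc_subset_uIcc hs
  rw [(h1 hs').deriv, (h2 hs').deriv]

theorem IsPrimitive.integral_mul_eq {F f G g : S1 → ℝ} (hF : IsPrimitive F f)
    (hG : IsPrimitive G g) (hf : Integrable f) (hg : Integrable g) :
    ∫ x, F x * g x = -∫ x, f x * G x := by
  have h := (hF.mul hG hf hg).integral_eq_zero
  rw [integral_add (integrable_mul_continuous hf (hG.continuous hg))
    (integrable_continuous_mul hg (hF.continuous hf))] at h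
  linarith

theorem isPrimitive_of_hasDerivAt {F g : S1 → ℝ} (hg : Continuous g)
    (h : ∀ s : ℝ, HasDerivAt (fun r : ℝ => F (r : S1)) (g (s : S1)) s) : IsPrimitive F g := by
  intro x y
  rw [intervalIntegral.integral_eq_sub_of_hasDerivAt (fun s _ => h s)]
  exact (hg.comp (AddCircle.continuous_mk' _)).intervalIntegrable _ _

theorem IsTestPair.isPrimitive {φ ψ : S1 → ℝ} (h : IsTestPair φ ψ) : IsPrimitive φ ψ :=
  isPrimitive_of_hasDerivAt h.continuous_snd h.deriv

theorem Continuous.integrable_S1 {φ : S1 → ℝ} (h : Continuous φ) : Integrable φ :=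
  h.integrable_of_hasCompactSupport (HasCompactSupport.of_compactSpace φ)

theorem integrable_L2S1 (f : L2S1) : Integrable f :=
  (Lp.memLp f).integrable (by norm_num)

theorem isWeakDeriv_of_isPrimitive {f g : L2S1} {F : S1 → ℝ} (hF : IsPrimitive F g)
    (hf : F =ᵐ[volume] f) : IsWeakDeriv f g := by
  intro φ ψ h
  rw [← hF.integral_mul_eq h.isPrimitive (integrable_L2S1 g) h.continuous_snd.integrable_S1]
  refine integral_congr_ae ?_
  filter_upwards [hf] with x hx
  rw [hx]

/-- Zero mean is exactly what makes the indefinite integral periodic. -/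
theorem exists_isPrimitive {g : S1 → ℝ} (hg : Integrable g) (h0 : ∫ x, g x = 0) :
    ∃ F : S1 → ℝ, IsPrimitive F g := by
  have hi := intervalIntegrable_lift hg
  have hper : Function.Periodic (fun s : ℝ => ∫ r in (0 : ℝ)..s, g (r : S1)) (2 * π) := by
    intro s
    simp only
    rw [← intervalIntegral.integral_add_adjacent_intervals (hi 0 s) (hi s (s + 2 * π)),
      ← integral_S1, h0, add_zero]
  refine ⟨hper.lift, fun x y => ?_⟩
  rw [Function.Periodic.lift_coe, Function.Periodic.lift_coe,
    intervalIntegral.integral_interval_sub_left (hi _ _) (hi _ _)]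

/-! ### Trigonometric test functions and representatives of `H¹` functions -/

theorem isTestPair_fourier_re (n : ℤ) :
    IsTestPair (fun x => (fourier n x).re) (fun x => -n * (fourier n x).im) := by
  have hd (s : ℝ) := hasDerivAt_fourier (2 * π) n s
  constructor
  · simp only [fourier_coe_apply]
    refine Complex.reCLM.contDiff.comp (Complex.contDiff_exp.comp ?_)
    have h : ContDiff ℝ (⊤ : ℕ∞) (fun s : ℝ => (s : ℂ)) := Complex.ofRealCLM.contDiff
    exact (contDiff_const.mul h).div_const _
  · intro s
    have h := Complex.reCLM.hasFDerivAt.comp_hasDerivAt s (hd s)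
    have h2 : 2 * (π : ℂ) * Complex.I * n / ((2 * π : ℝ) : ℂ) = ((n : ℝ) : ℂ) * Complex.I := by
      have : (π : ℂ) ≠ 0 := by exact_mod_cast pi_ne_zero
      push_cast
      field_simp
    rw [h2] at h
    convert! h using 1
    rw [Complex.reCLM_apply, mul_assoc, Complex.re_ofReal_mul]
    simp

theorem isTestPair_fourier_im (n : ℤ) :
    IsTestPair (fun x => (fourier n x).im) (fun x => n * (fourier n x).re) := by
  have hd (s : ℝ) := hasDerivAt_fourier (2 * π) n s
  constructor
  · simp only [fourier_coe_apply]
    refine Complex.imCLM.contDiff.comp (Complex.contDiff_exp.comp ?_)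
    have h : ContDiff ℝ (⊤ : ℕ∞) (fun s : ℝ => (s : ℂ)) := Complex.ofRealCLM.contDiff
    exact (contDiff_const.mul h).div_const _
  · intro s
    have h := Complex.imCLM.hasFDerivAt.comp_hasDerivAt s (hd s)
    have h2 : 2 * (π : ℂ) * Complex.I * n / ((2 * π : ℝ) : ℂ) = ((n : ℝ) : ℂ) * Complex.I := by
      have : (π : ℂ) ≠ 0 := by exact_mod_cast pi_ne_zero
      push_cast
      field_simp
    rw [h2] at h
    convert! h using 1
    rw [Complex.imCLM_apply, mul_assoc, Complex.im_ofReal_mul]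
    simp

theorem IsTestPair.const_mul {φ ψ : S1 → ℝ} (h : IsTestPair φ ψ) (c : ℝ) :
    IsTestPair (fun x => c * φ x) (fun x => c * ψ x) :=
  ⟨contDiff_const.mul h.smooth, fun s => (h.deriv s).const_mul c⟩

theorem isTestPair_one : IsTestPair (fun _ => 1) (fun _ => 0) :=
  ⟨contDiff_const, fun s => hasDerivAt_const s _⟩

/-- An `L²` function orthogonal to the trigonometric functions vanishes. -/
theorem ae_eq_zero_of_fourier {h : S1 → ℝ} (hh : MemLp h 2)
    (hre : ∀ n : ℤ, ∫ x, h x * (fourier n x).re = 0)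
    (him : ∀ n : ℤ, ∫ x, h x * (fourier n x).im = 0) : h =ᵐ[volume] 0 := by
  have hint : Integrable h := hh.integrable (by norm_num)
  have hc : MemLp (fun x => (h x : ℂ)) 2 (volume : Measure S1) := hh.ofReal
  have hc' : MemLp (fun x => (h x : ℂ)) 2 (AddCircle.haarAddCircle : Measure S1) :=
    memLp_haarAddCircle_iff.2 hc
  have hcoef (n : ℤ) : fourierCoeff (fun x : S1 => (h x : ℂ)) n = 0 := by
    rw [fourierCoeff, AddCircle.integral_haarAddCircle]
    have hi : Integrable (fun x : S1 => fourier (-n) x • (h x : ℂ)) := by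
      refine (hint.ofReal (𝕜 := ℂ)).bdd_mul (c := 1)
        ((fourier (-n)).continuous.aestronglyMeasurable) (Eventually.of_forall fun x => ?_)
      rw [fourier_apply, Circle.norm_coe]
    have : ∫ x : S1, fourier (-n) x • (h x : ℂ) = 0 := by
      apply Complex.ext
      · have := Complex.reCLM.integral_comp_comm hi
        simp only [Complex.reCLM_apply] at this
        rw [← this, Complex.zero_re, ← hre (-n)]
        refine integral_congr_ae (Eventually.of_forall fun x => ?_)
        simp [mul_comm]
      · have := Complex.imCLM.integral_comp_comm hi
        simp only [Complex.imCLM_apply] at this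
        rw [← this, Complex.zero_im, ← him (-n)]
        refine integral_congr_ae (Eventually.of_forall fun x => ?_)
        simp [mul_comm]
    rw [this, smul_zero]
  have hz : hc'.toLp _ = 0 := by
    apply (fourierBasis (T := 2 * π)).repr.injective
    ext n
    rw [fourierBasis_repr, fourierCoeff_congr_ae hc'.coeFn_toLp, hcoef]
    simp
  have h1 : (fun x => (h x : ℂ)) =ᵐ[(AddCircle.haarAddCircle : Measure S1)] 0 := by
    have := hc'.coeFn_toLp
    rw [hz] at this
    exact this.symm.trans (Lp.coeFn_zero _ _ _)
  have h2 : (fun x => (h x : ℂ)) =ᵐ[(volume : Measure S1)] 0 := by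
    rw [AddCircle.volume_eq_smul_haarAddCircle]
    exact Measure.ae_smul_measure h1 _
  filter_upwards [h2] with x hx
  simpa using hx

theorem ae_eq_zero_of_isTestPair {h : S1 → ℝ} (hh : MemLp h 2)
    (H : ∀ φ ψ, IsTestPair φ ψ → ∫ x, h x * φ x = 0) : h =ᵐ[volume] 0 :=
  ae_eq_zero_of_fourier hh (fun n => H _ _ (isTestPair_fourier_re n))
    (fun n => H _ _ (isTestPair_fourier_im n))

/-- Every nonconstant Fourier mode is the derivative of a mode divided by its frequency. Subtracting
the mean kills the zero mode as well, so `h - c` has no Fourier coefficients left. -/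
theorem exists_ae_eq_const_of_isTestPair {h : S1 → ℝ} (hh : MemLp h 2)
    (H : ∀ φ ψ, IsTestPair φ ψ → ∫ x, h x * ψ x = 0) : ∃ c : ℝ, h =ᵐ[volume] fun _ => c := by
  have hint : Integrable h := hh.integrable (by norm_num)
  set c : ℝ := (2 * π)⁻¹ * ∫ x, h x with hc
  have hm : MemLp (fun x => h x - c) 2 := hh.sub (memLp_const c)
  have hvol : (volume : Measure S1).real univ = 2 * π := by
    simp [Measure.real, pi_pos.le]
  have h0 : ∫ x, (h x - c) = 0 := by
    rw [integral_sub hint (integrable_const c), integral_const, hvol, hc, smul_eq_mul]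
    field_simp
    ring
  have hψ (φ ψ : S1 → ℝ) (hφ : IsTestPair φ ψ) : ∫ x, (h x - c) * ψ x = 0 := by
    have h1 := hφ.isPrimitive.integral_eq_zero
    simp only [sub_mul]
    rw [integral_sub (integrable_mul_continuous hint hφ.continuous_snd)
      (hφ.continuous_snd.integrable_S1.const_mul c), H φ ψ hφ, integral_const_mul, h1]
    simp
  have key : (fun x => h x - c) =ᵐ[volume] 0 := by
    refine ae_eq_zero_of_fourier hm (fun n => ?_) (fun n => ?_)
    · rcases eq_or_ne n 0 with rfl | hn
      · simpa using h0
      · have := hψ _ _ ((isTestPair_fourier_im n).const_mul (n : ℝ)⁻¹)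
        have hn' : (n : ℝ) ≠ 0 := by exact_mod_cast hn
        simpa [hn'] using this
    · rcases eq_or_ne n 0 with rfl | hn
      · simp
      · have := hψ _ _ ((isTestPair_fourier_re n).const_mul (-(n : ℝ)⁻¹))
        have hn' : (n : ℝ) ≠ 0 := by exact_mod_cast hn
        simpa [hn'] using this
  refine ⟨c, ?_⟩
  filter_upwards [key] with x hx
  have : h x - c = 0 := hx
  linarith

theorem IsPrimitive.add_const {F g : S1 → ℝ} (h : IsPrimitive F g) (c : ℝ) :
    IsPrimitive (fun x => F x + c) g := by
  intro x y
  rw [← h x y]; ring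

/-- A function with a weak derivative in `L²` has a representative which is a primitive of it. -/
theorem IsWeakDeriv.exists_isPrimitive {f g : L2S1} (h : IsWeakDeriv f g) :
    ∃ F : S1 → ℝ, IsPrimitive F g ∧ F =ᵐ[volume] f := by
  have hg := integrable_L2S1 g
  -- Testing against the constant function 1 shows that a weak derivative has zero mean.
  have h0 : ∫ x, g x = 0 := by
    have := h _ _ isTestPair_one
    simp at this
    linarith
  obtain ⟨F, hF⟩ := _root_.exists_isPrimitive hg h0
  have hFc := hF.continuous hg
  have hF2 : MemLp F 2 := hFc.memLp_of_hasCompactSupport (HasCompactSupport.of_compactSpace F)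
  obtain ⟨c, hc⟩ := exists_ae_eq_const_of_isTestPair (h := fun x => f x - F x)
    ((Lp.memLp f).sub hF2) (by
      intro φ ψ hφ
      simp only [sub_mul]
      rw [integral_sub (integrable_L2S1_mul f hφ.continuous_snd)
        (integrable_mul_continuous hFc.integrable_S1 hφ.continuous_snd), h φ ψ hφ,
        hF.integral_mul_eq hφ.isPrimitive hg hφ.continuous_snd.integrable_S1]
      ring)
  refine ⟨_, hF.add_const c, ?_⟩
  filter_upwards [hc] with x hx
  linarith

theorem IsWeakDeriv.unique {f g g' : L2S1} (h : IsWeakDeriv f g) (h' : IsWeakDeriv f g') :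
    g = g' := by
  have := ae_eq_zero_of_isTestPair (h := fun x => g x - g' x)
    ((Lp.memLp g).sub (Lp.memLp g')) (by
      intro φ ψ hφ
      simp only [sub_mul]
      rw [integral_sub (integrable_L2S1_mul g hφ.continuous_fst)
        (integrable_L2S1_mul g' hφ.continuous_fst)]
      linarith [h φ ψ hφ, h' φ ψ hφ])
  apply Lp.ext
  filter_upwards [this] with x hx
  have : g x - g' x = 0 := hx
  linarith

/-! ### The distance on the circle and the logarithmic singularity -/

theorem exists_rep (z : S1) : ∃ s : ℝ, (s : S1) = z ∧ |s| ≤ π ∧ ‖z‖ = |s| := by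
  have h := (AddCircle.equivIoc (2 * π) (-π)).symm_apply_apply z
  obtain ⟨⟨s, hs⟩, hz⟩ := (AddCircle.equivIoc (2 * π) (-π)).symm.surjective z
  have hz' : (s : S1) = z := hz
  have h1 : |s| ≤ π := abs_le.2 ⟨hs.1.le, by linarith [hs.2]⟩
  refine ⟨s, hz', h1, ?_⟩
  rw [← hz', AddCircle.norm_coe_eq_abs_iff _ (by positivity), abs_of_pos two_pi_pos]
  linarith

theorem norm_S1_le_pi (z : S1) : ‖z‖ ≤ π := by
  obtain ⟨s, -, h1, h2⟩ := exists_rep z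
  rwa [h2]

theorem norm_coe_S1 {s : ℝ} (hs : |s| ≤ π) : ‖(s : S1)‖ = |s| := by
  rw [AddCircle.norm_coe_eq_abs_iff _ (by positivity), abs_of_pos two_pi_pos]
  linarith

theorem periodic_abs_sin_half : Function.Periodic (fun s : ℝ => |sin (s / 2)|) (2 * π) := by
  intro s
  have h : (s + 2 * π) / 2 = s / 2 + π := by ring
  simp only [h, sin_add_pi, abs_neg]

/-- The function `s ↦ |sin (s / 2)|` on the circle. -/
def absSinHalf : S1 → ℝ := periodic_abs_sin_half.lift

theorem absSinHalf_coe (s : ℝ) : absSinHalf (s : S1) = |sin (s / 2)| :=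
  Function.Periodic.lift_coe _ _

theorem continuous_absSinHalf : Continuous absSinHalf := by
  apply continuous_of_lift
  simp only [absSinHalf_coe]
  fun_prop

theorem absSinHalf_nonneg (z : S1) : 0 ≤ absSinHalf z := by
  obtain ⟨s, rfl, -⟩ := exists_rep z
  rw [absSinHalf_coe]
  positivity

theorem absSinHalf_le_one (z : S1) : absSinHalf z ≤ 1 := by
  obtain ⟨s, rfl, -⟩ := exists_rep z
  rw [absSinHalf_coe]
  exact abs_sin_le_one _

theorem norm_div_pi_le_absSinHalf (z : S1) : ‖z‖ / π ≤ absSinHalf z := by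
  obtain ⟨s, rfl, hs, h⟩ := exists_rep z
  rw [absSinHalf_coe, h]
  have := mul_abs_le_abs_sin (x := s / 2) (by rw [abs_div, abs_two]; linarith)
  rw [abs_div, abs_two] at this
  calc |s| / π = 2 / π * (|s| / 2) := by ring
    _ ≤ _ := this

theorem absSinHalf_zero : absSinHalf 0 = 0 := by
  have := absSinHalf_coe 0
  simpa using this

theorem absSinHalf_sub_comm (x y : S1) : absSinHalf (x - y) = absSinHalf (y - x) := by
  obtain ⟨s, rfl, -⟩ := exists_rep x
  obtain ⟨t, rfl, -⟩ := exists_rep y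
  rw [← AddCircle.coe_sub, ← AddCircle.coe_sub, absSinHalf_coe, absSinHalf_coe,
    ← neg_sub t s, neg_div, sin_neg, abs_neg]

/-- The logarithmic singularity dominating the kernels. -/
def logSing (z : S1) : ℝ := -log (‖z‖ / π)

theorem logSing_nonneg (z : S1) : 0 ≤ logSing z := by
  rw [logSing, neg_nonneg]
  exact log_nonpos (by positivity) ((div_le_one pi_pos).2 (norm_S1_le_pi z))

theorem measurable_logSing : Measurable logSing :=
  (measurable_log.comp (measurable_norm.div_const _)).neg

theorem neg_log_absSinHalf_nonneg (z : S1) : 0 ≤ -log (absSinHalf z) := by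
  rw [neg_nonneg]
  exact log_nonpos (absSinHalf_nonneg z) (absSinHalf_le_one z)

theorem neg_log_absSinHalf_le (z : S1) : -log (absSinHalf z) ≤ logSing z := by
  rcases eq_or_ne z 0 with rfl | hz
  -- At the singularity both sides are 0, by the convention `log 0 = 0`.
  · simp [logSing, absSinHalf_zero]
  · have : 0 < ‖z‖ := norm_pos_iff.2 hz
    exact neg_le_neg (log_le_log (by positivity) (norm_div_pi_le_absSinHalf z))

/-- A contraction by `exp (-M)` costs only the summand `M` under the logarithm; the linear growth of
all later bounds comes from here. Since `logSing 0 = 0` by convention, the point `w = 0` has to be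
excluded. -/
theorem logSing_le_of_norm_le {z w : S1} {M : ℝ} (hw : w ≠ 0) (h : exp (-M) * ‖w‖ ≤ ‖z‖) :
    logSing z ≤ M + logSing w := by
  have hw' : 0 < ‖w‖ := norm_pos_iff.2 hw
  have h1 : log (exp (-M) * ‖w‖ / π) ≤ log (‖z‖ / π) :=
    log_le_log (by positivity) (by gcongr)
  rw [mul_div_assoc, log_mul (by positivity) (by positivity), log_exp] at h1
  rw [logSing, logSing]
  linarith

/-- The square integrability serves the velocity bounds; the fourth power controls the error of
truncating the kernel. -/
theorem integrable_logSing_pow_four : Integrable (fun z => logSing z ^ 4) := by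
  have hb (z : S1) : logSing z ^ 4 ≤ 4096 * (‖z‖ / π) ^ (-(1 / 2) : ℝ) := by
    rcases eq_or_ne z 0 with rfl | hz
    · simp [logSing]
    have hr : 0 < ‖z‖ / π := by have := norm_pos_iff.2 hz; positivity
    -- The exponent 1/8 is chosen so that the fourth power is an integrable inverse square root,
    -- with constant `8 ^ 4 = 4096`.
    have h1 : logSing z ≤ 8 * (‖z‖ / π) ^ (-(1 / 8) : ℝ) := by
      have := log_le_rpow_div (x := (‖z‖ / π)⁻¹) (ε := 1 / 8) (by positivity) (by norm_num)
      rw [log_inv] at this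
      rw [logSing, rpow_neg hr.le, ← inv_rpow hr.le]
      linarith
    calc logSing z ^ 4 ≤ (8 * (‖z‖ / π) ^ (-(1 / 8) : ℝ)) ^ 4 :=
          pow_le_pow_left₀ (logSing_nonneg z) h1 4
      _ = 4096 * (‖z‖ / π) ^ (-(1 / 2) : ℝ) := by
          rw [mul_pow, ← rpow_natCast ((‖z‖ / π) ^ (-(1 / 8) : ℝ)), ← rpow_mul hr.le]
          norm_num
  have hi : Integrable (fun z : S1 => 4096 * (‖z‖ / π) ^ (-(1 / 2) : ℝ)) := by
    apply Integrable.const_mul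
    have hmp := AddCircle.measurePreserving_mk (2 * π) (-π)
    have hm : Measurable (fun z : S1 => (‖z‖ / π) ^ (-(1 / 2) : ℝ)) :=
      (measurable_norm.div_const _).pow_const _
    rw [← hmp.integrable_comp hm.aestronglyMeasurable]
    have h1 : IntervalIntegrable (fun s : ℝ => |s| ^ (-(1 / 2) : ℝ)) volume (-π) (-π + 2 * π) := by
      have hpos (c : ℝ) (hc : 0 ≤ c) :
          IntervalIntegrable (fun s : ℝ => |s| ^ (-(1 / 2) : ℝ)) volume 0 c := by
        refine (intervalIntegral.intervalIntegrable_rpow' (r := -(1 / 2)) (by norm_num)).congr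
          (fun s hs => ?_)
        rw [uIoc_of_le hc] at hs
        simp only [abs_of_pos hs.1]
      have hneg : IntervalIntegrable (fun s : ℝ => |s| ^ (-(1 / 2) : ℝ)) volume (-π) 0 := by
        have := (hpos π pi_pos.le).comp_sub_left 0
        simp only [zero_sub, abs_neg, sub_self] at this
        simpa using this.symm
      exact hneg.trans (by simpa [two_mul] using hpos π pi_pos.le)
    rw [intervalIntegrable_iff_integrableOn_Ioc_of_le (by linarith [two_pi_pos])] at h1
    have h2 : IntegrableOn (fun s : ℝ => (|s| / π) ^ (-(1 / 2) : ℝ)) (Ioc (-π) (-π + 2 * π)) := by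
      refine (h1.div_const (π ^ (-(1 / 2) : ℝ))).congr (Eventually.of_forall fun s => ?_)
      simp only
      rw [div_rpow (abs_nonneg _) pi_pos.le]
    refine (integrableOn_congr_fun (fun s hs => ?_) measurableSet_Ioc).1 h2
    simp only [Function.comp]
    rw [norm_coe_S1 (abs_le.2 ⟨hs.1.le, by linarith [hs.2]⟩)]
  refine hi.mono' (measurable_logSing.pow_const 4).aestronglyMeasurable
    (Eventually.of_forall fun z => ?_)
  rw [norm_of_nonneg (pow_nonneg (logSing_nonneg z) 4)]
  exact hb z

theorem memLp_logSing : MemLp logSing 2 := by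
  rw [memLp_two_iff_integrable_sq measurable_logSing.aestronglyMeasurable]
  refine (integrable_logSing_pow_four.add (integrable_const (1 : ℝ))).mono'
    (measurable_logSing.pow_const 2).aestronglyMeasurable (Eventually.of_forall fun z => ?_)
  rw [norm_of_nonneg (by positivity), Pi.add_apply]
  nlinarith [sq_nonneg (logSing z ^ 2 - 1)]

theorem memLp_log_absSinHalf : MemLp (fun z => log (absSinHalf z)) 2 := by
  refine memLp_logSing.mono
    (measurable_log.comp continuous_absSinHalf.measurable).aestronglyMeasurable
    (Eventually.of_forall fun z => ?_)
  rw [norm_eq_abs, norm_eq_abs, abs_of_nonneg (logSing_nonneg z), ← abs_neg,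
    abs_of_nonneg (neg_log_absSinHalf_nonneg z)]
  exact neg_log_absSinHalf_le z

/-! ### The logarithmic kernel and the Hilbert transform -/

/-- The additive constant normalising the logarithmic kernel to have zero mean. -/
def kernelConst : ℝ := -((2 * π)⁻¹ * ∫ z, π⁻¹ * log (absSinHalf z))

/-- The convolution kernel `K` with `H f = K * f_x`. -/
def logKernel (z : S1) : ℝ := π⁻¹ * log (absSinHalf z) + kernelConst

theorem measurable_logKernel : Measurable logKernel :=
  ((measurable_log.comp continuous_absSinHalf.measurable).const_mul _).add_const _

theorem memLp_logKernel : MemLp logKernel 2 :=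
  (memLp_log_absSinHalf.const_mul _).add (memLp_const _)

theorem abs_logKernel_le (z : S1) : |logKernel z| ≤ |kernelConst| + logSing z := by
  have h1 : π⁻¹ ≤ 1 := inv_le_one_of_one_le₀ (by linarith [pi_gt_three])
  have h2 := neg_log_absSinHalf_nonneg z
  have h3 := neg_log_absSinHalf_le z
  have h4 : |π⁻¹ * log (absSinHalf z)| ≤ logSing z := by
    rw [abs_mul, abs_of_pos (by positivity), ← abs_neg, abs_of_nonneg h2]
    nlinarith
  calc _ ≤ |π⁻¹ * log (absSinHalf z)| + |kernelConst| := abs_add_le _ _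
    _ ≤ _ := by linarith

theorem volume_real_S1 : (volume : Measure S1).real univ = 2 * π := by
  simp [Measure.real, pi_pos.le]

theorem integral_logKernel : ∫ z, logKernel z = 0 := by
  have h := (memLp_log_absSinHalf.const_mul π⁻¹).integrable (by norm_num)
  simp only [logKernel]
  rw [integral_add h (integrable_const _), integral_const, volume_real_S1, kernelConst, smul_eq_mul]
  field_simp
  ring

theorem integrable_logKernel : Integrable logKernel := memLp_logKernel.integrable (by norm_num)

/-- A periodic primitive exists because `kernelConst` removes the mean. Its free additive constant
drops out when it is integrated against densities of zero mean. -/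
theorem exists_kernelPrim : ∃ F, IsPrimitive F logKernel :=
  exists_isPrimitive integrable_logKernel integral_logKernel

/-- A primitive of the kernel `logKernel`. -/
def kernelPrim : S1 → ℝ := exists_kernelPrim.choose

theorem isPrimitive_kernelPrim : IsPrimitive kernelPrim logKernel := exists_kernelPrim.choose_spec

theorem continuous_kernelPrim : Continuous kernelPrim :=
  isPrimitive_kernelPrim.continuous integrable_logKernel

theorem memLp_logKernel_sub (x : S1) : MemLp (fun y => logKernel (x - y)) 2 :=
  memLp_logKernel.comp_measurePreserving (Measure.measurePreserving_sub_left volume x)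

theorem memLp_logSing_sub (x : S1) : MemLp (fun y => logSing (x - y)) 2 :=
  memLp_logSing.comp_measurePreserving (Measure.measurePreserving_sub_left volume x)

theorem cotHalf_coe (s : ℝ) : cotHalf (s : S1) = cot (s / 2) :=
  Function.Periodic.lift_coe _ _

theorem HasHilbertTransformAt.congr_ae {f f' : S1 → ℝ} {x : S1} {h : ℝ}
    (H : HasHilbertTransformAt f x h) (hf : f =ᵐ[volume] f') : HasHilbertTransformAt f' x h := by
  have (ε : ℝ) : ∫ y in {y : S1 | ε < dist x y}, f' y * cotHalf (x - y) =
      ∫ y in {y : S1 | ε < dist x y}, f y * cotHalf (x - y) := by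
    refine integral_congr_ae (ae_restrict_of_ae ?_)
    filter_upwards [hf] with y hy
    rw [hy]
  simpa only [HasHilbertTransformAt, this] using H

/-- The period window starts at the singular point, so excising a ball around that point just trims
both ends of one interval. -/
theorem lt_dist_coe_iff {x s ε : ℝ} (hε : ε < π) (hs : s ∈ Ioc x (x + 2 * π)) :
    ε < dist (x : S1) (s : S1) ↔ s ∈ Ioo (x + ε) (x + 2 * π - ε) := by
  rw [dist_eq_norm, ← AddCircle.coe_sub]
  rcases le_or_gt (s - x) π with h | h
  · rw [norm_coe_S1 (by rw [abs_sub_comm, abs_of_pos (by linarith [hs.1])]; exact h),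
      abs_sub_comm, abs_of_pos (by linarith [hs.1]), mem_Ioo]
    constructor
    · intro h1; constructor <;> linarith
    · intro h1; linarith [h1.1]
  · have h1 : ((x - s : ℝ) : S1) = ((x - s + 2 * π : ℝ) : S1) := (AddCircle.coe_add_period _ _).symm
    have h2 : |x - s + 2 * π| = x - s + 2 * π := abs_of_nonneg (by linarith [hs.2])
    rw [h1, norm_coe_S1 (by rw [h2]; linarith), h2, mem_Ioo]
    constructor
    · intro h1; constructor <;> linarith
    · intro h1; linarith [h1.2]

theorem setIntegral_lt_dist_eq (f : S1 → ℝ) {x ε : ℝ} (hε0 : 0 < ε) (hε : ε < π) :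
    ∫ y in {y : S1 | ε < dist (x : S1) y}, f y = ∫ s in (x + ε)..(x + 2 * π - ε), f (s : S1) := by
  have hm : MeasurableSet {y : S1 | ε < dist (x : S1) y} :=
    (isOpen_lt continuous_const (continuous_const.dist continuous_id)).measurableSet
  rw [← integral_indicator hm, ← AddCircle.integral_preimage (2 * π) x,
    intervalIntegral.integral_of_le (by linarith), integral_Ioc_eq_integral_Ioo (x := x + ε),
    ← integral_indicator measurableSet_Ioo, ← integral_indicator measurableSet_Ioc]
  congr 1
  funext s
  by_cases hs : s ∈ Ioc x (x + 2 * π)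
  · rw [indicator_of_mem hs]
    by_cases h : ε < dist (x : S1) (s : S1)
    · rw [indicator_of_mem (by exact h), indicator_of_mem ((lt_dist_coe_iff hε hs).1 h)]
    · rw [indicator_of_notMem (by exact h),
        indicator_of_notMem (fun h' => h ((lt_dist_coe_iff hε hs).2 h'))]
  · rw [indicator_of_notMem hs, indicator_of_notMem]
    intro h
    exact hs ⟨by linarith [h.1], by linarith [h.2]⟩

/-- Integration by parts on the trimmed window, half the cotangent being the derivative of `log
sin`. The two ends carry the same logarithm because `sin (π - ε/2) = sin (ε/2)`, so the boundary
terms combine into a difference of values of `F`. -/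
theorem integral_mul_cotHalf_eq {F g : S1 → ℝ} (hF : IsPrimitive F g) (hg : Integrable g)
    {x ε : ℝ} (hε0 : 0 < ε) (hε : ε < π) :
    ∫ y in {y : S1 | ε < dist (x : S1) y}, F y * cotHalf ((x : S1) - y) =
      2 * (∫ s in (x + ε)..(x + 2 * π - ε), g (s : S1) * log (absSinHalf ((x : S1) - (s : S1)))) -
      2 * ((F ((x - ε : ℝ) : S1) - F ((x + ε : ℝ) : S1)) * log (sin (ε / 2))) := by
  rw [setIntegral_lt_dist_eq _ hε0 hε]
  set a := x + ε
  set b := x + 2 * π - ε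
  have hab : a ≤ b := by simp only [a, b]; linarith
  set L : ℝ → ℝ := fun s => log (sin ((s - x) / 2)) with hL
  have hpos (s : ℝ) (hs : s ∈ Icc a b) : 0 < sin ((s - x) / 2) := by
    apply sin_pos_of_pos_of_lt_pi
    · simp only [a, b] at hs; linarith [hs.1]
    · simp only [a, b] at hs; linarith [hs.2]
  have hLd (s : ℝ) (hs : s ∈ Icc a b) : HasDerivAt L (cot ((s - x) / 2) / 2) s := by
    have h1 : HasDerivAt (fun s : ℝ => (s - x) / 2) (1 / 2) s :=
      ((hasDerivAt_id s).sub_const x).div_const 2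
    have h2 := (h1.sin).log (hpos s hs).ne'
    convert! h2 using 1
    rw [cot_eq_cos_div_sin]
    ring
  have hLc : AbsolutelyContinuousOnInterval L a b := by
    apply ContDiffOn.absolutelyContinuousOnInterval
    rw [uIcc_of_le hab]
    refine ContDiffOn.log ?_ (fun s hs => (hpos s hs).ne')
    fun_prop
  have hmain := AbsolutelyContinuousOnInterval.integral_deriv_mul_eq_sub
    (hF.absolutelyContinuousOnInterval hg a b) hLc
  have hLa : L a = log (sin (ε / 2)) := by simp only [hL, a]; ring_nf
  have hLb : L b = log (sin (ε / 2)) := by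
    simp only [hL, b]
    rw [show (x + 2 * π - ε - x) / 2 = π - ε / 2 by ring, sin_pi_sub]
  have hFb : F (b : S1) = F ((x - ε : ℝ) : S1) := by
    rw [← AddCircle.coe_add_period (2 * π) (x - ε)]
    simp only [b]
    ring_nf
  rw [hLa, hLb, hFb] at hmain
  have hcongr : ∫ s in a..b, deriv (fun s : ℝ => F (s : S1)) s * L s + F (s : S1) * deriv L s =
      ∫ s in a..b, (g (s : S1) * log (absSinHalf ((x : S1) - (s : S1))) -
        (F (s : S1) * cotHalf ((x : S1) - s)) / 2) := by
    refine intervalIntegral.integral_congr_ae ?_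
    filter_upwards [hF.ae_hasDerivAt hg a b] with s hs hs1
    have hs2 : s ∈ Icc a b := by rw [← uIcc_of_le hab]; exact uIoc_subset_uIcc hs1
    rw [(hs (uIoc_subset_uIcc hs1)).deriv, (hLd s hs2).deriv, absSinHalf_sub_comm,
      ← AddCircle.coe_sub, ← AddCircle.coe_sub, absSinHalf_coe, abs_of_pos (hpos s hs2),
      cotHalf_coe, ← neg_sub s x, neg_div, cot_eq_cos_div_sin, cot_eq_cos_div_sin, cos_neg,
      sin_neg]
    simp only [hL]
    ring
  have hFi : ContinuousOn (fun s : ℝ => F (s : S1)) (uIcc a b) :=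
    ((hF.continuous hg).comp (AddCircle.continuous_mk' _)).continuousOn
  have hLi : ContinuousOn L (uIcc a b) := by
    rw [uIcc_of_le hab]
    exact fun s hs => (hLd s hs).continuousAt.continuousWithinAt
  have hi1 : IntervalIntegrable
      (fun s : ℝ => g (s : S1) * log (absSinHalf ((x : S1) - (s : S1)))) volume a b := by
    refine ((intervalIntegrable_lift hg a b).mul_continuousOn hLi).congr (fun s hs => ?_)
    have hs2 : s ∈ Icc a b := by rw [← uIcc_of_le hab]; exact uIoc_subset_uIcc hs
    rw [absSinHalf_sub_comm, ← AddCircle.coe_sub, absSinHalf_coe, abs_of_pos (hpos s hs2)]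
  have hi2 : IntervalIntegrable
      (fun s : ℝ => (F (s : S1) * cotHalf ((x : S1) - s)) / 2) volume a b := by
    apply ContinuousOn.intervalIntegrable
    refine (hFi.mul ?_).div_const 2
    rw [uIcc_of_le hab]
    have : ContinuousOn (fun s : ℝ => cos ((x - s) / 2) / sin ((x - s) / 2)) (Icc a b) := by
      refine ContinuousOn.div (by fun_prop) (by fun_prop) (fun s hs => ?_)
      rw [← neg_sub, neg_div, sin_neg, neg_ne_zero]
      exact (hpos s hs).ne'
    refine this.congr (fun s _ => ?_)
    rw [← AddCircle.coe_sub, cotHalf_coe, cot_eq_cos_div_sin]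
  rw [hcongr, intervalIntegral.integral_sub hi1 hi2, intervalIntegral.integral_div] at hmain
  linarith

/-- Hölder continuity with exponent 1/2, obtained from `|g| ≤ 1/(2√ε) + (√ε/2) g²` integrated over
an interval of length `2ε`. -/
theorem abs_sub_le_of_isPrimitive {F g : S1 → ℝ} (hF : IsPrimitive F g) (hg : MemLp g 2)
    {x ε : ℝ} (hε0 : 0 < ε) (hε : ε < π) :
    |F ((x - ε : ℝ) : S1) - F ((x + ε : ℝ) : S1)| ≤ (1 + (∫ y, g y ^ 2) / 2) * √ε := by
  have hgi : Integrable g := hg.integrable (by norm_num)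
  have hle : x - ε ≤ x + ε := by linarith
  rw [abs_sub_comm, hF]
  have hi2 := intervalIntegrable_lift hg.integrable_sq
  have hsq : 0 < √ε := sqrt_pos.2 hε0
  have h1 : ∫ s in (x - ε)..(x + ε), |g (s : S1)| ≤
      ∫ s in (x - ε)..(x + ε), ((√ε)⁻¹ / 2 + √ε / 2 * g (s : S1) ^ 2) := by
    refine intervalIntegral.integral_mono_on hle (intervalIntegrable_lift hgi _ _).abs
      (intervalIntegrable_const.add ((hi2 _ _).const_mul _)) (fun s _ => ?_)
    have h2 := sq_nonneg (1 - √ε * |g (s : S1)|)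
    have h3 : (√ε)⁻¹ / 2 + √ε / 2 * g (s : S1) ^ 2 - |g (s : S1)| =
        (√ε)⁻¹ / 2 * (1 - √ε * |g (s : S1)|) ^ 2 := by
      rw [← sq_abs (g (s : S1))]
      field_simp
      ring
    have : 0 ≤ (√ε)⁻¹ / 2 * (1 - √ε * |g (s : S1)|) ^ 2 := by positivity
    linarith
  have h2 : ∫ s in (x - ε)..(x + ε), g (s : S1) ^ 2 ≤ ∫ y, g y ^ 2 := by
    rw [integral_S1 (fun y => g y ^ 2) (x - ε)]
    refine intervalIntegral.integral_mono_interval le_rfl hle (by linarith)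
      (Eventually.of_forall fun s => sq_nonneg _) (hi2 _ _)
  calc _ ≤ ∫ s in (x - ε)..(x + ε), |g (s : S1)| :=
        intervalIntegral.abs_integral_le_integral_abs hle
    _ ≤ _ := h1
    _ = √ε + √ε / 2 * ∫ s in (x - ε)..(x + ε), g (s : S1) ^ 2 := by
        rw [intervalIntegral.integral_add intervalIntegrable_const ((hi2 _ _).const_mul _),
          intervalIntegral.integral_const, intervalIntegral.integral_const_mul, smul_eq_mul,
          show x + ε - (x - ε) = 2 * ε by ring]
        congr 1
        have := mul_self_sqrt hε0.le
        field_simp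
        linarith
    _ ≤ √ε + √ε / 2 * ∫ y, g y ^ 2 := by gcongr
    _ = _ := by ring

theorem tendsto_sqrt_mul_log_sin :
    Tendsto (fun ε : ℝ => √ε * log (sin (ε / 2))) (𝓝[>] 0) (𝓝 0) := by
  have h1 := tendsto_log_mul_rpow_nhdsGT_zero (r := 1 / 2) (by norm_num)
  have h2 : Tendsto (fun ε : ℝ => √ε) (𝓝[>] 0) (𝓝 0) := by
    have := (continuous_sqrt.tendsto 0).mono_left (nhdsWithin_le_nhds (s := Ioi 0))
    simpa using this
  have h3 : Tendsto (fun ε : ℝ => -(√ε * log π) + log ε * ε ^ (1 / 2 : ℝ)) (𝓝[>] 0) (𝓝 0) := by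
    have := (h2.mul_const (log π)).neg.add h1
    simpa using this
  refine tendsto_of_tendsto_of_tendsto_of_le_of_le' h3 tendsto_const_nhds ?_ ?_
  · filter_upwards [Ioo_mem_nhdsGT pi_pos] with ε hε
    have h4 := norm_div_pi_le_absSinHalf (ε : S1)
    rw [absSinHalf_coe, norm_coe_S1 (by rw [abs_of_pos hε.1]; exact hε.2.le), abs_of_pos hε.1,
      abs_of_pos (sin_pos_of_pos_of_lt_pi (by linarith [hε.1]) (by linarith [hε.1, hε.2]))] at h4
    have h5 := log_le_log (by have := hε.1; positivity) h4
    rw [log_div hε.1.ne' pi_ne_zero] at h5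
    rw [← sqrt_eq_rpow]
    nlinarith [sqrt_nonneg ε]
  · filter_upwards [Ioo_mem_nhdsGT pi_pos] with ε hε
    refine mul_nonpos_of_nonneg_of_nonpos (sqrt_nonneg _) (log_nonpos ?_ (sin_le_one _))
    exact (sin_pos_of_pos_of_lt_pi (by linarith [hε.1]) (by linarith [hε.1, hε.2])).le

/-- The Hilbert transform of an `H¹` function is the convolution of its derivative with the
logarithmic kernel. -/
theorem hasHilbertTransformAt_of_isPrimitive {F g : S1 → ℝ} (hF : IsPrimitive F g)
    (hg : MemLp g 2) (x : S1) :
    HasHilbertTransformAt F x (∫ y, logKernel (x - y) * g y) := by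
  obtain ⟨x, rfl, -⟩ := exists_rep x
  have hgi : Integrable g := hg.integrable (by norm_num)
  set q : S1 → ℝ := fun y => g y * log (absSinHalf ((x : S1) - y)) with hq
  have hqi : Integrable q := hg.integrable_mul (memLp_log_absSinHalf.comp_measurePreserving
    (Measure.measurePreserving_sub_left volume (x : S1)))
  have hK : ∫ y, logKernel ((x : S1) - y) * g y = π⁻¹ * ∫ s in x..(x + 2 * π), q (s : S1) := by
    -- The additive constant of the kernel is harmless, since `g` has zero mean.
    have : (fun y => logKernel ((x : S1) - y) * g y) =
        fun y => π⁻¹ * q y + kernelConst * g y := by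
      funext y
      simp only [logKernel, hq]
      ring
    rw [this, integral_add (hqi.const_mul _) (hgi.const_mul _), integral_const_mul,
      integral_const_mul, hF.integral_eq_zero, mul_zero, add_zero, integral_S1 q x]
  have hqc := intervalIntegrable_lift hqi
  have hlim : Tendsto (fun ε : ℝ => ∫ s in (x + ε)..(x + 2 * π - ε), q (s : S1)) (𝓝[>] 0)
      (𝓝 (∫ s in x..(x + 2 * π), q (s : S1))) := by
    have h1 : Continuous fun b : ℝ => ∫ s in x..b, q (s : S1) :=
      intervalIntegral.continuous_primitive hqc x
    have h2 : Continuous fun ε : ℝ =>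
        (∫ s in x..(x + 2 * π - ε), q (s : S1)) - ∫ s in x..(x + ε), q (s : S1) :=
      (h1.comp (by fun_prop)).sub (h1.comp (by fun_prop))
    have h3 := (h2.tendsto 0).mono_left (nhdsWithin_le_nhds (s := Ioi 0))
    simp only [add_zero, sub_zero, intervalIntegral.integral_same] at h3
    refine h3.congr (fun ε => ?_)
    rw [intervalIntegral.integral_interval_sub_left (hqc _ _) (hqc _ _)]
  -- The boundary term is `O(√ε |log sin (ε/2)|)`, and the square root beats the logarithm.
  have hbd : Tendsto (fun ε : ℝ => (F ((x - ε : ℝ) : S1) - F ((x + ε : ℝ) : S1)) *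
      log (sin (ε / 2))) (𝓝[>] 0) (𝓝 0) := by
    have h1 := (tendsto_sqrt_mul_log_sin.norm).const_mul (1 + (∫ y, g y ^ 2) / 2)
    simp only [norm_zero, mul_zero] at h1
    refine squeeze_zero_norm' ?_ h1
    filter_upwards [Ioo_mem_nhdsGT pi_pos] with ε hε
    rw [norm_mul, norm_mul, norm_of_nonneg (sqrt_nonneg ε), ← mul_assoc]
    gcongr
    exact abs_sub_le_of_isPrimitive hF hg hε.1 hε.2
  rw [HasHilbertTransformAt, hK]
  have h := ((hlim.const_mul 2).sub (hbd.const_mul 2)).const_mul (1 / (2 * π))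
  rw [show 1 / (2 * π) * (2 * (∫ s in x..(x + 2 * π), q (s : S1)) - 2 * 0) =
    π⁻¹ * ∫ s in x..(x + 2 * π), q (s : S1) by field_simp; ring] at h
  refine h.congr' ?_
  filter_upwards [Ioo_mem_nhdsGT pi_pos] with ε hε
  rw [integral_mul_cotHalf_eq hF hgi hε.1 hε.2]

/-! ### Circle maps with slopes bounded below -/

/-- The circle map `b ↦ b + e(b)` with displacement `e`. -/
def shiftMap (e : C(S1, ℝ)) (b : S1) : S1 := b + (e b : S1)

/-- The lift `b ↦ b + e(b)` has all its slopes bounded below by `c`. -/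
def HasSlopeGE (c : ℝ) (e : C(S1, ℝ)) : Prop :=
  ∀ a b : ℝ, a ≤ b → c * (b - a) ≤ (b + e (b : S1)) - (a + e (a : S1))

theorem continuous_shiftMap_uncurry : Continuous fun p : C(S1, ℝ) × S1 => shiftMap p.1 p.2 :=
  continuous_snd.add ((AddCircle.continuous_mk' _).comp (by fun_prop))

theorem continuous_shiftMap (e : C(S1, ℝ)) : Continuous (shiftMap e) :=
  continuous_shiftMap_uncurry.comp (by fun_prop : Continuous fun b : S1 => (e, b))

theorem shiftMap_coe (e : C(S1, ℝ)) (b : ℝ) : shiftMap e (b : S1) = ((b + e (b : S1) : ℝ) : S1) := by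
  rw [shiftMap, AddCircle.coe_add]

theorem le_norm_coe_S1 {u r : ℝ} (h1 : u ≤ r) (h2 : r ≤ 2 * π - u) (hu : 0 ≤ u) :
    u ≤ ‖(r : S1)‖ := by
  rcases le_or_gt r π with h | h
  · rw [norm_coe_S1 (by rw [abs_of_nonneg (hu.trans h1)]; exact h), abs_of_nonneg (hu.trans h1)]
    exact h1
  · have h3 : ((r : ℝ) : S1) = ((r - 2 * π : ℝ) : S1) := by
      rw [← AddCircle.coe_add_period (2 * π) (r - 2 * π), sub_add_cancel]
    have h4 : |r - 2 * π| = 2 * π - r := by rw [abs_sub_comm, abs_of_nonneg (by linarith)]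
    rw [h3, norm_coe_S1 (by rw [h4]; linarith), h4]
    linarith

/-- The distance of the images is the shorter of the two image arcs, so both arcs between the points
must be bounded below: the short one and its complement, which is at least as long. -/
theorem HasSlopeGE.mul_norm_le {c : ℝ} {e : C(S1, ℝ)} (h : HasSlopeGE c e) (hc : 0 ≤ c)
    (a b : S1) : c * ‖a - b‖ ≤ ‖shiftMap e a - shiftMap e b‖ := by
  have key (α s : ℝ) (hs : 0 ≤ s) (hs' : s ≤ π) :
      c * s ≤ ‖shiftMap e (α : S1) - shiftMap e ((α - s : ℝ) : S1)‖ := by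
    rw [shiftMap_coe, shiftMap_coe, ← AddCircle.coe_sub]
    have h1 := h (α - s) α (by linarith)
    have h2 := h α (α - s + 2 * π) (by linarith [pi_pos])
    rw [AddCircle.coe_add_period] at h2
    refine le_norm_coe_S1 ?_ ?_ (by positivity)
    · linarith
    · nlinarith
  obtain ⟨α, rfl, -⟩ := exists_rep a
  obtain ⟨s, hs1, hs2, hs3⟩ := exists_rep ((α : S1) - b)
  have hb : b = ((α - s : ℝ) : S1) := by rw [AddCircle.coe_sub, hs1]; abel
  rw [hs3]
  rcases le_total 0 s with h0 | h0
  · rw [abs_of_nonneg h0] at hs2 ⊢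
    rw [hb]
    exact key α s h0 hs2
  · rw [abs_of_nonpos h0] at hs2 ⊢
    rw [hb, norm_sub_rev]
    have := key (α - s) (-s) (by linarith) hs2
    rwa [show α - s - -s = α by ring] at this

theorem shiftMap_surjective (e : C(S1, ℝ)) : Function.Surjective (shiftMap e) := by
  intro x
  obtain ⟨ξ, rfl, -⟩ := exists_rep x
  have hc : Continuous fun b : ℝ => b + e (b : S1) :=
    continuous_id.add (e.continuous.comp (AddCircle.continuous_mk' _))
  have hb (b : S1) : |e b| ≤ ‖e‖ := e.norm_coe_le_norm b
  have ht : Tendsto (fun b : ℝ => b + e (b : S1)) atTop atTop :=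
    tendsto_atTop_add_right_of_le _ (-‖e‖) tendsto_id (fun b => neg_le_of_abs_le (hb b))
  have hb' : Tendsto (fun b : ℝ => b + e (b : S1)) atBot atBot :=
    tendsto_atBot_add_right_of_ge _ ‖e‖ tendsto_id (fun b => le_of_abs_le (hb b))
  obtain ⟨b, hb⟩ := hc.surjective ht hb' ξ
  refine ⟨b, ?_⟩
  rw [shiftMap_coe]
  exact congrArg _ hb

theorem HasSlopeGE.logSing_le {M : ℝ} {e : C(S1, ℝ)} (h : HasSlopeGE (exp (-M)) e) {y b : S1}
    (hb : b ≠ y) : logSing (shiftMap e y - shiftMap e b) ≤ M + logSing (y - b) :=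
  logSing_le_of_norm_le (sub_ne_zero.2 hb.symm) (h.mul_norm_le (exp_pos _).le y b)

theorem HasSlopeGE.add_const {c : ℝ} {e : C(S1, ℝ)} (h : HasSlopeGE c e) (r : ℝ) :
    HasSlopeGE c (e + ContinuousMap.const S1 r) := by
  intro a b hab
  have := h a b hab
  simp only [ContinuousMap.add_apply, ContinuousMap.const_apply]
  linarith

/-- The class is convex, so velocities of two maps can be compared along the segment joining their
displacements. -/
theorem HasSlopeGE.lineMap {c : ℝ} {e η : C(S1, ℝ)} (h : HasSlopeGE c e)
    (h' : HasSlopeGE c (e + η)) {s : ℝ} (hs : s ∈ Icc (0 : ℝ) 1) : HasSlopeGE c (e + s • η) := by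
  intro a b hab
  have h1 := h a b hab
  have h2 := h' a b hab
  simp only [ContinuousMap.add_apply, ContinuousMap.smul_apply, smul_eq_mul] at h2 ⊢
  nlinarith [hs.1, hs.2, mul_le_mul_of_nonneg_left h1 (sub_nonneg.2 hs.2),
    mul_le_mul_of_nonneg_left h2 hs.1]

theorem HasSlopeGE.mono {c c' : ℝ} {e : C(S1, ℝ)} (h : HasSlopeGE c e) (hc : c' ≤ c) :
    HasSlopeGE c' e := fun a b hab =>
  (mul_le_mul_of_nonneg_right hc (by linarith)).trans (h a b hab)

/-! ### Bounds for the generated velocity -/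

/-- The velocity field `∫ K₁(x - X(b)) g(b) db` generated by the pushforward of `g db` under the
circle map `X` with displacement `e`. -/
def velocity (g : S1 → ℝ) (e : C(S1, ℝ)) (x : S1) : ℝ :=
  ∫ b, kernelPrim (x - shiftMap e b) * g b

/-- The space derivative of `velocity`. -/
def velocityDeriv (g : S1 → ℝ) (e : C(S1, ℝ)) (x : S1) : ℝ :=
  ∫ b, logKernel (x - shiftMap e b) * g b

/-- The bound for the space derivative of the velocity in terms of the logarithm `M` of the
inverse minimal slope. -/
def velocityBound (g : S1 → ℝ) (M : ℝ) : ℝ :=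
  (∫ b, |g b|) * M + (|kernelConst| * (∫ b, |g b|) + ((∫ z, logSing z ^ 2) + ∫ b, g b ^ 2) / 2)

theorem velocityBound_nonneg (g : S1 → ℝ) {M : ℝ} (hM : 0 ≤ M) : 0 ≤ velocityBound g M := by
  have h1 : 0 ≤ ∫ b, |g b| := integral_nonneg fun _ => abs_nonneg _
  have h2 : 0 ≤ ∫ z, logSing z ^ 2 := integral_nonneg fun _ => sq_nonneg _
  have h3 : 0 ≤ ∫ b, g b ^ 2 := integral_nonneg fun _ => sq_nonneg _
  rw [velocityBound]
  positivity

theorem ae_ne_S1 (y : S1) : ∀ᵐ b : S1, b ≠ y := by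
  have h : volume ({y} : Set S1) = 0 := by
    rw [← Metric.closedBall_zero, AddCircle.volume_closedBall]
    simp [two_pi_pos.le]
  exact compl_mem_ae_iff.2 h

/-- Write `x` as the image of some `y`. The slope bound replaces the singularity at `X(y) - X(b)` by
`M` plus one at `y - b`, which no longer depends on the map. Young's inequality separates the latter
from `g`, and translation invariance makes the integral independent of `y`. Thus `M` is multiplied
only by the `L¹` norm of `g`. -/
theorem exists_dominating_logKernel {g : S1 → ℝ} (hg : MemLp g 2) {M : ℝ} {e : C(S1, ℝ)}
    (h : HasSlopeGE (exp (-M)) e) (x : S1) :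
    ∃ B : S1 → ℝ, Integrable B ∧ ∫ b, B b = velocityBound g M ∧
      ∀ᵐ b, |logKernel (x - shiftMap e b)| * |g b| ≤ B b := by
  obtain ⟨y, rfl⟩ := shiftMap_surjective e x
  have hgi : Integrable g := hg.integrable (by norm_num)
  have h1 := hgi.abs.const_mul M
  have h2 := hgi.abs.const_mul |kernelConst|
  have h3 : Integrable (fun b => logSing (y - b) ^ 2) := (memLp_logSing_sub y).integrable_sq
  have h4 := hg.integrable_sq
  have h34 : Integrable (fun b => (logSing (y - b) ^ 2 + g b ^ 2) / 2) :=
    (h3.add h4).div_const 2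
  have h5 : Integrable
      (fun b => |kernelConst| * |g b| + (logSing (y - b) ^ 2 + g b ^ 2) / 2) := h2.add h34
  have h6 : Integrable (fun b => M * |g b| + (|kernelConst| * |g b| +
      (logSing (y - b) ^ 2 + g b ^ 2) / 2)) := h1.add h5
  refine ⟨_, h6, ?_, ?_⟩
  · rw [integral_add h1 h5, integral_add h2 h34, integral_div, integral_add h3 h4,
      integral_const_mul, integral_const_mul,
      integral_sub_left_eq_self (fun z => logSing z ^ 2) volume y, velocityBound, mul_comm M]
  · filter_upwards [ae_ne_S1 y] with b hb
    have h5 := h.logSing_le hb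
    have h6 := abs_logKernel_le (shiftMap e y - shiftMap e b)
    have h7 : |logKernel (shiftMap e y - shiftMap e b)| * |g b| ≤
        (|kernelConst| + (M + logSing (y - b))) * |g b| := by gcongr; linarith
    have h8 := sq_nonneg (logSing (y - b) - |g b|)
    rw [sub_sq, sq_abs] at h8
    linarith

theorem measurable_logKernel_sub_shiftMap (e : C(S1, ℝ)) (x : S1) :
    Measurable fun b => logKernel (x - shiftMap e b) :=
  measurable_logKernel.comp (continuous_const.sub (continuous_shiftMap e)).measurable

theorem integrable_logKernel_mul {g : S1 → ℝ} (hg : MemLp g 2) {M : ℝ} {e : C(S1, ℝ)}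
    (h : HasSlopeGE (exp (-M)) e) (x : S1) :
    Integrable (fun b => logKernel (x - shiftMap e b) * g b) := by
  obtain ⟨B, hB, -, hle⟩ := exists_dominating_logKernel hg h x
  refine hB.mono' ((measurable_logKernel_sub_shiftMap e x).aestronglyMeasurable.mul
    hg.aestronglyMeasurable) ?_
  filter_upwards [hle] with b hb
  rwa [norm_mul, norm_eq_abs, norm_eq_abs]

theorem integral_abs_logKernel_mul_le {g : S1 → ℝ} (hg : MemLp g 2) {M : ℝ} {e : C(S1, ℝ)}
    (h : HasSlopeGE (exp (-M)) e) (x : S1) :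
    ∫ b, |logKernel (x - shiftMap e b)| * |g b| ≤ velocityBound g M := by
  obtain ⟨B, hB, hB', hle⟩ := exists_dominating_logKernel hg h x
  rw [← hB']
  refine integral_mono_ae ?_ hB hle
  simpa only [norm_mul, norm_eq_abs] using (integrable_logKernel_mul hg h x).norm

theorem abs_velocityDeriv_le {g : S1 → ℝ} (hg : MemLp g 2) {M : ℝ} {e : C(S1, ℝ)}
    (h : HasSlopeGE (exp (-M)) e) (x : S1) : |velocityDeriv g e x| ≤ velocityBound g M := by
  refine le_trans ?_ (integral_abs_logKernel_mul_le hg h x)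
  rw [velocityDeriv]
  simpa only [norm_mul, norm_eq_abs] using norm_integral_le_integral_norm
    (fun b => logKernel (x - shiftMap e b) * g b)

theorem continuous_velocity {g : S1 → ℝ} (hg : Integrable g) :
    Continuous fun p : C(S1, ℝ) × S1 => velocity g p.1 p.2 := by
  obtain ⟨C, hC⟩ : BddAbove (range fun x => ‖kernelPrim x‖) :=
    (isCompact_range continuous_kernelPrim.norm).bddAbove
  refine continuous_of_dominated (bound := fun b => C * ‖g b‖) (fun p => ?_) (fun p => ?_)
    (hg.norm.const_mul C) (Eventually.of_forall fun b => ?_)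
  · exact (continuous_kernelPrim.comp (continuous_const.sub
      (continuous_shiftMap p.1))).aestronglyMeasurable.mul hg.aestronglyMeasurable
  · refine Eventually.of_forall fun b => ?_
    rw [norm_mul]
    gcongr
    exact hC ⟨_, rfl⟩
  · refine (continuous_kernelPrim.comp (continuous_snd.sub ?_)).mul continuous_const
    exact continuous_shiftMap_uncurry.comp (by fun_prop : Continuous
      fun p : C(S1, ℝ) × S1 => (p.1, b))

theorem exists_abs_velocity_le {g : S1 → ℝ} (hg : Integrable g) :
    ∃ C, 0 ≤ C ∧ ∀ e x, |velocity g e x| ≤ C := by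
  obtain ⟨C, hC⟩ : BddAbove (range fun x => ‖kernelPrim x‖) :=
    (isCompact_range continuous_kernelPrim.norm).bddAbove
  have hC0 : 0 ≤ C := (norm_nonneg _).trans (hC ⟨0, rfl⟩)
  refine ⟨C * ∫ b, ‖g b‖, by positivity, fun e x => ?_⟩
  rw [← integral_const_mul, ← norm_eq_abs, velocity]
  refine norm_integral_le_of_norm_le (hg.norm.const_mul C) (Eventually.of_forall fun b => ?_)
  rw [norm_mul]
  gcongr
  exact hC ⟨_, rfl⟩

theorem shiftMap_add (e η : C(S1, ℝ)) (b : S1) :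
    shiftMap (e + η) b = shiftMap e b + (η b : S1) := by
  rw [shiftMap, shiftMap, ContinuousMap.add_apply, AddCircle.coe_add, add_assoc]

/-- Moving the evaluation point is the same as shifting the map the other way, so regularity in `x`
follows from regularity in the displacement. -/
theorem velocity_add_const (g : S1 → ℝ) (e : C(S1, ℝ)) (x : S1) (r : ℝ) :
    velocity g (e + ContinuousMap.const S1 (-r)) x = velocity g e (x + r) := by
  simp only [velocity, shiftMap_add, ContinuousMap.const_apply]
  congr 1
  funext b
  rw [AddCircle.coe_neg]
  congr 2
  abel

theorem velocityDeriv_add_const (g : S1 → ℝ) (e : C(S1, ℝ)) (x : S1) (r : ℝ) :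
    velocityDeriv g (e + ContinuousMap.const S1 (-r)) x = velocityDeriv g e (x + r) := by
  simp only [velocityDeriv, shiftMap_add, ContinuousMap.const_apply]
  congr 1
  funext b
  rw [AddCircle.coe_neg]
  congr 2
  abel

theorem kernelPrim_sub_eq (z : S1) (η : ℝ) :
    kernelPrim (z - (η : S1)) - kernelPrim z =
      -(η * ∫ s in (0 : ℝ)..1, logKernel (z - ((s * η : ℝ) : S1))) := by
  obtain ⟨β, rfl, -⟩ := exists_rep z
  have h := isPrimitive_kernelPrim (β - η) β
  have h2 := intervalIntegral.smul_integral_comp_sub_mul (a := 0) (b := 1)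
    (fun r : ℝ => logKernel (r : S1)) η β
  simp only [mul_one, mul_zero, sub_zero, smul_eq_mul] at h2
  simp only [← AddCircle.coe_sub, mul_comm _ η]
  rw [h2, ← h]
  ring

theorem integrable_prod_logKernel {g : S1 → ℝ} (hg : MemLp g 2) {M : ℝ}
    {e η : C(S1, ℝ)} (h : HasSlopeGE (exp (-M)) e) (h' : HasSlopeGE (exp (-M)) (e + η)) (x : S1) :
    Integrable (fun p : ℝ × S1 => logKernel (x - shiftMap (e + p.1 • η) p.2) * g p.2)
      ((volume.restrict (Ioc (0 : ℝ) 1)).prod volume) := by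
  have hcont : Continuous fun p : ℝ × S1 => x - shiftMap (e + p.1 • η) p.2 := by
    exact continuous_const.sub (continuous_shiftMap_uncurry.comp
      (by fun_prop : Continuous fun p : ℝ × S1 => (e + p.1 • η, p.2)))
  have hmeas : AEStronglyMeasurable
      (fun p : ℝ × S1 => logKernel (x - shiftMap (e + p.1 • η) p.2) * g p.2)
      ((volume.restrict (Ioc (0 : ℝ) 1)).prod volume) :=
    (measurable_logKernel.comp hcont.measurable).aestronglyMeasurable.mul
      hg.aestronglyMeasurable.comp_snd
  rw [integrable_prod_iff hmeas]
  constructor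
  · refine (ae_restrict_iff' measurableSet_Ioc).2 (Eventually.of_forall fun s hs => ?_)
    exact integrable_logKernel_mul hg (h.lineMap h' ⟨hs.1.le, hs.2⟩) x
  · refine Integrable.mono' (integrable_const (velocityBound g M)) hmeas.norm.integral_prod_right' ?_
    refine (ae_restrict_iff' measurableSet_Ioc).2 (Eventually.of_forall fun s hs => ?_)
    rw [norm_of_nonneg (integral_nonneg fun _ => norm_nonneg _)]
    simpa only [norm_mul, norm_eq_abs] using
      integral_abs_logKernel_mul_le hg (h.lineMap h' ⟨hs.1.le, hs.2⟩) x

/-- The fundamental theorem of calculus along the segment from `e` to `e + η`, for each particle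
`b`, followed by Fubini. Convexity of the slope class bounds the singular integrand uniformly along
the segment. -/
theorem velocity_add_sub {g : S1 → ℝ} (hg : MemLp g 2) {M : ℝ}
    {e η : C(S1, ℝ)} (h : HasSlopeGE (exp (-M)) e) (h' : HasSlopeGE (exp (-M)) (e + η)) (x : S1) :
    velocity g (e + η) x - velocity g e x =
      -∫ s in (0 : ℝ)..1, ∫ b, η b * (logKernel (x - shiftMap (e + s • η) b) * g b) := by
  have hgi : Integrable g := hg.integrable (by norm_num)
  have hk (e : C(S1, ℝ)) : Integrable fun b => kernelPrim (x - shiftMap e b) * g b :=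
    integrable_continuous_mul hgi (continuous_kernelPrim.comp
      (continuous_const.sub (continuous_shiftMap e)))
  have hF := integrable_prod_logKernel hg h h' x
  have hF' : Integrable
      (fun p : ℝ × S1 => η p.2 * (logKernel (x - shiftMap (e + p.1 • η) p.2) * g p.2))
      ((volume.restrict (Ioc (0 : ℝ) 1)).prod volume) :=
    hF.bdd_mul (c := ‖η‖) (by fun_prop) (Eventually.of_forall fun p => η.norm_coe_le_norm _)
  rw [intervalIntegral.integral_of_le zero_le_one, integral_integral_swap hF', velocity, velocity,
    ← integral_sub (hk _) (hk _), ← integral_neg]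
  refine integral_congr_ae (Eventually.of_forall fun b => ?_)
  simp only [shiftMap_add, ContinuousMap.smul_apply, smul_eq_mul, ← sub_sub]
  rw [← sub_mul, kernelPrim_sub_eq, intervalIntegral.integral_of_le zero_le_one,
    integral_const_mul, integral_mul_const]
  ring

theorem abs_velocity_sub_le {g : S1 → ℝ} (hg : MemLp g 2) {M : ℝ} {e e' : C(S1, ℝ)}
    (h : HasSlopeGE (exp (-M)) e) (h' : HasSlopeGE (exp (-M)) e') (x : S1) :
    |velocity g e' x - velocity g e x| ≤ velocityBound g M * ‖e' - e‖ := by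
  obtain ⟨η, rfl⟩ : ∃ η, e' = e + η := ⟨e' - e, by abel⟩
  rw [velocity_add_sub hg h h', abs_neg, add_sub_cancel_left]
  have := intervalIntegral.norm_integral_le_of_norm_le_const (a := 0) (b := 1)
    (C := velocityBound g M * ‖η‖)
    (f := fun s : ℝ => ∫ b, η b * (logKernel (x - shiftMap (e + s • η) b) * g b)) (by
      intro s hs
      rw [uIoc_of_le zero_le_one] at hs
      have hs' := h.lineMap h' ⟨hs.1.le, hs.2⟩
      have hint := (integrable_logKernel_mul hg hs' x).norm
      simp only [norm_mul, norm_eq_abs] at hint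
      calc _ ≤ ∫ b, ‖η‖ * (|logKernel (x - shiftMap (e + s • η) b)| * |g b|) := by
            refine norm_integral_le_of_norm_le (hint.const_mul _) (Eventually.of_forall fun b => ?_)
            rw [norm_mul, norm_mul, norm_eq_abs (logKernel _), norm_eq_abs (g b)]
            gcongr
            exact η.norm_coe_le_norm b
        _ ≤ ‖η‖ * velocityBound g M := by
            rw [integral_const_mul]
            gcongr
            exact integral_abs_logKernel_mul_le hg hs' x
        _ = _ := mul_comm _ _)
  simpa using this

theorem velocity_coe_add_sub {g : S1 → ℝ} (hg : MemLp g 2) {M : ℝ} {e : C(S1, ℝ)}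
    (h : HasSlopeGE (exp (-M)) e) (x : S1) (r : ℝ) :
    velocity g e (x + r) - velocity g e x =
      r * ∫ s in (0 : ℝ)..1, velocityDeriv g e (x + ((s * r : ℝ) : S1)) := by
  rw [← velocity_add_const, velocity_add_sub hg h (h.add_const _),
    ← intervalIntegral.integral_const_mul, ← intervalIntegral.integral_neg]
  refine intervalIntegral.integral_congr fun s _ => ?_
  have h1 : e + s • ContinuousMap.const S1 (-r) = e + ContinuousMap.const S1 (-(s * r)) := by
    ext b
    simp
  simp only [ContinuousMap.const_apply]
  rw [integral_const_mul, h1, ← velocityDeriv_add_const, velocityDeriv]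
  ring

/-! ### Continuity of the velocity derivative -/

/-- The logarithmic kernel with its singularity cut off at the level `-N`. -/
def truncKernel (N : ℝ) (z : S1) : ℝ := π⁻¹ * log (max (absSinHalf z) (exp (-N))) + kernelConst

theorem continuous_truncKernel (N : ℝ) : Continuous (truncKernel N) :=
  (continuous_const.mul ((continuous_absSinHalf.max continuous_const).log
    fun _ => (lt_max_of_lt_right (exp_pos _)).ne')).add continuous_const

/-- The kernels differ only where `logSing` exceeds `N`; there one factor `logSing` bounds the
difference, and a second one, divided by `N`, is at least 1. -/
theorem abs_logKernel_sub_truncKernel_le {N : ℝ} (hN : 0 < N) {z : S1} (hz : z ≠ 0) :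
    |logKernel z - truncKernel N z| ≤ N⁻¹ * logSing z ^ 2 := by
  have hs : 0 < absSinHalf z := by
    have := norm_pos_iff.2 hz
    exact lt_of_lt_of_le (by positivity) (norm_div_pi_le_absSinHalf z)
  rw [logKernel, truncKernel, add_sub_add_right_eq_sub, ← mul_sub]
  rcases le_or_gt (exp (-N)) (absSinHalf z) with h | h
  · rw [max_eq_left h, sub_self, mul_zero, abs_zero]
    positivity
  · rw [max_eq_right h.le, log_exp]
    have h1 : log (absSinHalf z) < -N := by rwa [← log_exp (-N), log_lt_log_iff hs (exp_pos _)]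
    have h2 := neg_log_absSinHalf_le z
    have h3 : π⁻¹ ≤ 1 := inv_le_one_of_one_le₀ (by linarith [pi_gt_three])
    have h4 : |log (absSinHalf z) - -N| ≤ logSing z := by
      rw [abs_of_nonpos (by linarith)]; linarith
    have h5 : N ≤ logSing z := by linarith
    calc _ = π⁻¹ * |log (absSinHalf z) - -N| := by rw [abs_mul, abs_of_pos (by positivity)]
      _ ≤ 1 * logSing z := by gcongr
      _ ≤ (N⁻¹ * logSing z) * logSing z := by
          gcongr
          · exact logSing_nonneg z
          · rw [inv_mul_eq_div]; exact (one_le_div hN).2 h5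
      _ = _ := by ring

/-- The velocity derivative with truncated kernel. -/
def truncVelocityDeriv (N : ℝ) (g : S1 → ℝ) (e : C(S1, ℝ)) (x : S1) : ℝ :=
  ∫ b, truncKernel N (x - shiftMap e b) * g b

theorem integrable_logSing_sub_pow_four (y : S1) : Integrable (fun b => logSing (y - b) ^ 4) := by
  have h := (Measure.measurePreserving_sub_left volume y).integrable_comp_of_integrable
    integrable_logSing_pow_four
  simpa only [Function.comp_def] using h

theorem abs_velocityDeriv_sub_trunc_le {g : S1 → ℝ} (hg : MemLp g 2) {M N : ℝ} (hN : 0 < N)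
    {e : C(S1, ℝ)} (he : HasSlopeGE (exp (-M)) e) (x : S1) :
    |velocityDeriv g e x - truncVelocityDeriv N g e x| ≤
      N⁻¹ * (2 * M ^ 2 * (∫ b, |g b|) + ((∫ z, logSing z ^ 4) + ∫ b, g b ^ 2)) := by
  have hgi : Integrable g := hg.integrable (by norm_num)
  have hg2 := hg.integrable_sq
  obtain ⟨y, rfl⟩ := shiftMap_surjective e x
  have h4 := integrable_logSing_sub_pow_four y
  have hi1 : Integrable (fun b => 2 * M ^ 2 * |g b|) := hgi.abs.const_mul _
  have hi2 : Integrable (fun b => logSing (y - b) ^ 4 + g b ^ 2) := h4.add hg2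
  have hi3 : Integrable (fun b => 2 * M ^ 2 * |g b| + (logSing (y - b) ^ 4 + g b ^ 2)) :=
    hi1.add hi2
  have hCy : 2 * M ^ 2 * (∫ b, |g b|) + ((∫ z, logSing z ^ 4) + ∫ b, g b ^ 2) =
      ∫ b, (2 * M ^ 2 * |g b| + (logSing (y - b) ^ 4 + g b ^ 2)) := by
    rw [integral_add hi1 hi2, integral_add h4 hg2, integral_const_mul,
      integral_sub_left_eq_self (fun z => logSing z ^ 4) volume y]
  have ht : Integrable (fun b => truncKernel N (shiftMap e y - shiftMap e b) * g b) :=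
    integrable_continuous_mul hgi ((continuous_truncKernel N).comp
      (continuous_const.sub (continuous_shiftMap e)))
  rw [velocityDeriv, truncVelocityDeriv, ← integral_sub (integrable_logKernel_mul hg he _) ht, hCy,
    ← integral_const_mul, ← norm_eq_abs]
  refine norm_integral_le_of_norm_le (hi3.const_mul _) ?_
  filter_upwards [ae_ne_S1 y] with b hb
  have hne : shiftMap e y - shiftMap e b ≠ 0 := by
    rw [← norm_pos_iff]
    refine lt_of_lt_of_le ?_ (he.mul_norm_le (exp_pos _).le y b)
    have := norm_pos_iff.2 (sub_ne_zero.2 hb.symm)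
    positivity
  rw [← sub_mul, norm_mul, norm_eq_abs, norm_eq_abs]
  have h1 := abs_logKernel_sub_truncKernel_le hN hne
  have h2 := he.logSing_le hb
  have h3 := logSing_nonneg (shiftMap e y - shiftMap e b)
  generalize logKernel (shiftMap e y - shiftMap e b) -
    truncKernel N (shiftMap e y - shiftMap e b) = k at *
  generalize logSing (shiftMap e y - shiftMap e b) = l at *
  generalize logSing (y - b) = m at *
  have h5 : l ^ 2 ≤ 2 * M ^ 2 + 2 * m ^ 2 := by
    nlinarith [sq_nonneg (M - m)]
  have h6 : 2 * (m ^ 2 * |g b|) ≤ m ^ 4 + g b ^ 2 := by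
    rw [← sq_abs (g b)]
    nlinarith [sq_nonneg (m ^ 2 - |g b|)]
  calc _ ≤ (N⁻¹ * l ^ 2) * |g b| := by gcongr
    _ ≤ N⁻¹ * ((2 * M ^ 2 + 2 * m ^ 2) * |g b|) := by
        rw [mul_assoc]; gcongr
    _ ≤ _ := by
        gcongr
        linarith

theorem continuous_truncVelocityDeriv (N : ℝ) {g : S1 → ℝ} (hgi : Integrable g) :
    Continuous fun p : C(S1, ℝ) × S1 => truncVelocityDeriv N g p.1 p.2 := by
  obtain ⟨B, hB⟩ : BddAbove (range fun x => ‖truncKernel N x‖) :=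
    (isCompact_range (continuous_truncKernel _).norm).bddAbove
  refine continuous_of_dominated (bound := fun b => B * ‖g b‖) (fun p => ?_) (fun p => ?_)
    (hgi.norm.const_mul B) (Eventually.of_forall fun b => ?_)
  · exact ((continuous_truncKernel _).comp (continuous_const.sub
      (continuous_shiftMap p.1))).aestronglyMeasurable.mul hgi.aestronglyMeasurable
  · refine Eventually.of_forall fun b => ?_
    rw [norm_mul]
    gcongr
    exact hB ⟨_, rfl⟩
  · refine ((continuous_truncKernel _).comp (continuous_snd.sub ?_)).mul continuous_const
    exact continuous_shiftMap_uncurry.comp (by fun_prop : Continuous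
      fun p : C(S1, ℝ) × S1 => (p.1, b))

/-- For fixed `M` the truncated versions, which are continuous, converge at rate `1/N` uniformly in
the map and the point. -/
theorem continuousOn_velocityDeriv {g : S1 → ℝ} (hg : MemLp g 2) (M : ℝ) :
    ContinuousOn (fun p : C(S1, ℝ) × S1 => velocityDeriv g p.1 p.2)
      {p | HasSlopeGE (exp (-M)) p.1} := by
  set C : ℝ := 2 * M ^ 2 * (∫ b, |g b|) + ((∫ z, logSing z ^ 4) + ∫ b, g b ^ 2)
  have hC0 : 0 ≤ C := by
    have h1 : 0 ≤ ∫ b, |g b| := integral_nonneg fun _ => abs_nonneg _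
    have h2 : 0 ≤ ∫ z, logSing z ^ 4 := integral_nonneg fun _ => by positivity
    have h3 : 0 ≤ ∫ b, g b ^ 2 := integral_nonneg fun _ => sq_nonneg _
    positivity
  refine continuousOn_of_uniform_approx_of_continuousOn fun u hu => ?_
  obtain ⟨ε, hε, hεu⟩ := Metric.mem_uniformity_dist.1 hu
  have hN : 0 < (C + 1) / ε := by positivity
  refine ⟨fun p => truncVelocityDeriv ((C + 1) / ε) g p.1 p.2,
    (continuous_truncVelocityDeriv _ (hg.integrable (by norm_num))).continuousOn, fun p hp => ?_⟩
  apply hεu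
  rw [Real.dist_eq]
  refine (abs_velocityDeriv_sub_trunc_le hg hN hp p.2).trans_lt ?_
  rw [inv_div, div_mul_eq_mul_div, div_lt_iff₀ (by positivity)]
  nlinarith

/-! ### The retraction onto maps with a given minimal slope -/

/-- A retraction of the displacements onto those with slopes at least `c`. -/
def slopeRetract (c : ℝ) (e : C(S1, ℝ)) : C(S1, ℝ) where
  toFun a := sSup ((fun s : ℝ => e (a - (s : S1)) - (1 - c) * s) '' Icc 0 (2 * π))
  continuous_toFun := by
    refine IsCompact.continuous_sSup isCompact_Icc ?_
    have h : Continuous fun p : S1 × ℝ => e (p.1 - (p.2 : S1)) :=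
      e.continuous.comp (continuous_fst.sub ((AddCircle.continuous_mk' _).comp continuous_snd))
    exact h.sub (by fun_prop)

theorem isCompact_slopeRetract_image (c : ℝ) (e : C(S1, ℝ)) (a : S1) :
    IsCompact ((fun s : ℝ => e (a - (s : S1)) - (1 - c) * s) '' Icc 0 (2 * π)) := by
  refine isCompact_Icc.image ?_
  have h : Continuous fun s : ℝ => e (a - (s : S1)) :=
    e.continuous.comp (continuous_const.sub (AddCircle.continuous_mk' _))
  exact h.sub (by fun_prop)

theorem le_slopeRetract (c : ℝ) (e : C(S1, ℝ)) (a : S1) {s : ℝ} (hs : s ∈ Icc 0 (2 * π)) :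
    e (a - (s : S1)) - (1 - c) * s ≤ slopeRetract c e a :=
  le_csSup (isCompact_slopeRetract_image c e a).bddAbove ⟨s, hs, rfl⟩

theorem slopeRetract_le {c : ℝ} {e : C(S1, ℝ)} {a : S1} {B : ℝ}
    (h : ∀ s ∈ Icc 0 (2 * π), e (a - ((s : ℝ) : S1)) - (1 - c) * s ≤ B) :
    slopeRetract c e a ≤ B := by
  refine csSup_le (Nonempty.image _ ⟨0, by simp [pi_pos.le]⟩) ?_
  rintro _ ⟨s, hs, rfl⟩
  exact h s hs

theorem exists_coe_eq_mem_Icc {u : ℝ} (hu : 0 ≤ u) :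
    ∃ v ∈ Icc 0 (2 * π), v ≤ u ∧ (v : S1) = (u : S1) := by
  have h := toIcoMod_mem_Ico two_pi_pos 0 u
  rw [zero_add] at h
  refine ⟨_, Ico_subset_Icc_self h, ?_, ?_⟩
  · have h1 := toIcoMod_add_toIcoDiv_zsmul two_pi_pos 0 u
    have h2 : 0 ≤ toIcoDiv two_pi_pos 0 u := by
      by_contra hneg
      have h3 : toIcoDiv two_pi_pos 0 u ≤ -1 := by omega
      have h4 : (toIcoDiv two_pi_pos 0 u : ℝ) ≤ -1 := by exact_mod_cast h3
      rw [zsmul_eq_mul] at h1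
      nlinarith [h.2, two_pi_pos]
    have h5 : (0 : ℝ) ≤ toIcoDiv two_pi_pos 0 u := by exact_mod_cast h2
    rw [zsmul_eq_mul] at h1
    nlinarith [two_pi_pos]
  · conv_rhs => rw [← toIcoMod_add_toIcoDiv_zsmul two_pi_pos 0 u]
    rw [AddCircle.coe_add, AddCircle.coe_zsmul, AddCircle.coe_period, smul_zero, add_zero]

/-- The slope condition says that `(1 - c) r + e(r)` is nondecreasing on the line, and the
retraction takes the running maximum of this function. Periodicity and `c ≤ 1` make a look-back over
one period sufficient. -/
theorem hasSlopeGE_slopeRetract {c : ℝ} (hc : c ≤ 1) (e : C(S1, ℝ)) :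
    HasSlopeGE c (slopeRetract c e) := by
  intro a b hab
  have key : slopeRetract c e (a : S1) ≤ slopeRetract c e (b : S1) + (1 - c) * (b - a) := by
    refine slopeRetract_le fun s hs => ?_
    -- The point `a - s` is seen from `b` with look-back `s + (b - a)`; reducing it modulo the
    -- period only lowers the penalty.
    obtain ⟨v, hv, hvu, hvc⟩ := exists_coe_eq_mem_Icc (u := s + (b - a)) (by linarith [hs.1])
    have h1 := le_slopeRetract c e (b : S1) hv
    have h2 : (b : S1) - (v : S1) = (a : S1) - (s : S1) := by
      rw [hvc, AddCircle.coe_add, AddCircle.coe_sub]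
      abel
    rw [h2] at h1
    nlinarith
  linarith

theorem HasSlopeGE.slopeRetract_eq {c : ℝ} {e : C(S1, ℝ)} (h : HasSlopeGE c e) :
    slopeRetract c e = e := by
  ext a
  obtain ⟨α, rfl, -⟩ := exists_rep a
  apply le_antisymm
  · refine slopeRetract_le fun s hs => ?_
    have := h (α - s) α (by linarith [hs.1])
    rw [AddCircle.coe_sub] at this
    linarith
  · have := le_slopeRetract c e (α : S1) (s := 0) (by simp [pi_pos.le])
    simpa using this

/-- A supremum is 1-Lipschitz in its family, and the slope parameter is multiplied by a look-back of
at most `2 * π`. -/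
theorem norm_slopeRetract_sub_le (c c' : ℝ) (e e' : C(S1, ℝ)) :
    ‖slopeRetract c e - slopeRetract c' e'‖ ≤ ‖e - e'‖ + 2 * π * |c - c'| := by
  have key (c c' : ℝ) (e e' : C(S1, ℝ)) (a : S1) :
      slopeRetract c e a ≤ slopeRetract c' e' a + (‖e - e'‖ + 2 * π * |c - c'|) := by
    refine slopeRetract_le fun s hs => ?_
    have h1 := le_slopeRetract c' e' a hs
    have h2 := le_of_abs_le ((e - e').norm_coe_le_norm (a - (s : S1)))
    rw [ContinuousMap.sub_apply] at h2
    have h3 : (c - c') * s ≤ 2 * π * |c - c'| := by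
      have h4 := mul_le_mul_of_nonneg_right (le_abs_self (c - c')) hs.1
      have h5 := mul_le_mul_of_nonneg_left hs.2 (abs_nonneg (c - c'))
      linarith
    linarith
  rw [ContinuousMap.norm_le _ (by positivity)]
  intro a
  rw [norm_eq_abs, ContinuousMap.sub_apply, abs_sub_le_iff]
  have h1 := key c c' e e' a
  have h2 := key c' c e' e a
  rw [norm_sub_rev, abs_sub_comm] at h2
  constructor <;> linarith

/-! ### Global ODE solutions -/

/-- Global solutions of bounded, locally uniformly Lipschitz time dependent vector fields. -/
theorem exists_global_hasDerivAt {E : Type*} [NormedAddCommGroup E] [NormedSpace ℝ E]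
    [CompleteSpace E] (V : ℝ → E → E) (x₀ : E) {C : ℝ} (hC : 0 ≤ C)
    (hV : ∀ t x, ‖V t x‖ ≤ C) (hcont : ∀ x, Continuous fun t => V t x)
    (hlip : ∀ T : ℝ, ∃ K : NNReal, ∀ t ∈ Icc (-T) T, LipschitzWith K (V t)) :
    ∃ α : ℝ → E, α 0 = x₀ ∧ ∀ t, HasDerivAt α (V t (α t)) t := by
  have hex (n : ℕ) : ∃ α : ℝ → E, α 0 = x₀ ∧
      ∀ t ∈ Ioo (-(n + 1 : ℝ)) (n + 1), HasDerivAt α (V t (α t)) t := by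
    obtain ⟨K, hK⟩ := hlip (n + 1)
    have hn : (0 : ℝ) ≤ n + 1 := by positivity
    -- Since the field is bounded by `C`, a ball of radius `C (n + 1)` cannot be left during time `n
    -- + 1`.
    have hPL : IsPicardLindelof V (tmin := -(n + 1 : ℝ)) (tmax := n + 1)
        ⟨0, by simp only [mem_Icc]; constructor <;> linarith⟩ x₀
        (⟨C, hC⟩ * ⟨n + 1, hn⟩) 0 ⟨C, hC⟩ K := by
      refine ⟨fun t ht => (hK t ht).lipschitzOnWith, fun x _ => (hcont x).continuousOn,
        fun t _ x _ => hV t x, ?_⟩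
      simp
      rfl
    obtain ⟨α, h0, h⟩ := hPL.exists_eq_forall_mem_Icc_hasDerivWithinAt₀
    exact ⟨α, h0, fun t ht => (h t (Ioo_subset_Icc_self ht)).hasDerivAt (Icc_mem_nhds ht.1 ht.2)⟩
  choose α h0 hα using hex
  have huniq (m n : ℕ) (hmn : m ≤ n) : EqOn (α m) (α n) (Ioo (-(m + 1 : ℝ)) (m + 1)) := by
    obtain ⟨K, hK⟩ := hlip (m + 1)
    have hmn' : (m : ℝ) ≤ n := by exact_mod_cast hmn
    have hm : (0 : ℝ) ≤ m := by positivity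
    refine ODE_solution_unique_of_mem_Ioo (v := V) (s := fun _ => univ) (K := K) (t₀ := 0)
      (fun t ht => (hK t (Ioo_subset_Icc_self ht)).lipschitzOnWith)
      ⟨by linarith, by linarith⟩ (fun t ht => ⟨hα m t ht, trivial⟩)
      (fun t ht => ⟨hα n t ⟨by linarith [ht.1], by linarith [ht.2]⟩, trivial⟩) ?_
    rw [h0, h0]
  -- The solution of index `n` lives on `(-(n+1), n+1)`, so index `⌈|t|⌉₊` keeps `t` strictly
  -- inside.
  refine ⟨fun t => α ⌈|t|⌉₊ t, h0 _, fun t => ?_⟩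
  set n := ⌈|t|⌉₊ + 1 with hn
  have heq (s : ℝ) (hs : |s| < |t| + 1) : α ⌈|s|⌉₊ s = α n s := by
    refine huniq _ _ ?_ ?_
    · rw [hn, Nat.ceil_le]
      push_cast
      linarith [Nat.le_ceil |t|]
    · rw [mem_Ioo, ← abs_lt]
      linarith [Nat.le_ceil |s|]
  have ht : t ∈ Ioo (-(n + 1 : ℝ)) (n + 1) := by
    rw [mem_Ioo, ← abs_lt, hn]
    push_cast
    linarith [Nat.le_ceil |t|]
  have hev : (fun s => α ⌈|s|⌉₊ s) =ᶠ[𝓝 t] α n := by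
    have : ∀ᶠ s in 𝓝 t, |s| < |t| + 1 :=
      continuous_abs.continuousAt.eventually_lt_const (by linarith)
    filter_upwards [this] with s hs
    exact heq s hs
  have := (hα n t ht).congr_of_eventuallyEq hev
  rwa [← heq t (by linarith)] at this

/-! ### Slopes and Jacobian of a flow -/

/-- The mean of `ux` between the images at time `t` of two points. -/
def meanSlope (ux : ℝ → S1 → ℝ) (d : ℝ → C(S1, ℝ)) (a a' t : ℝ) : ℝ :=
  ∫ s in (0 : ℝ)..1, ux t (shiftMap (d t) (a : S1) +
    ((s * ((a' + d t (a' : S1)) - (a + d t (a : S1))) : ℝ) : S1))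

/-- The Jacobian of the flow of a velocity field with space derivative `ux`. -/
def flowJac (ux : ℝ → S1 → ℝ) (d : ℝ → C(S1, ℝ)) (t : ℝ) (a : S1) : ℝ :=
  exp (∫ s in (0 : ℝ)..t, ux s (shiftMap (d s) a))

theorem continuous_eval_S1 {X : Type*} [TopologicalSpace X] {d : X → C(S1, ℝ)} {f : X → S1}
    (hd : Continuous d) (hf : Continuous f) : Continuous fun x => d x (f x) := by
  fun_prop

theorem continuous_shiftMap_comp {X : Type*} [TopologicalSpace X] {d : X → C(S1, ℝ)} {f : X → S1}
    (hd : Continuous d) (hf : Continuous f) : Continuous fun x => shiftMap (d x) (f x) :=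
  continuous_shiftMap_uncurry.comp (hd.prodMk hf)

theorem continuous_coe_S1 {X : Type*} [TopologicalSpace X] {f : X → ℝ} (hf : Continuous f) :
    Continuous fun x => (f x : S1) :=
  (AddCircle.continuous_mk' _).comp hf

theorem continuous_meanSlope {ux : ℝ → S1 → ℝ} (hux : Continuous (Function.uncurry ux))
    {d : ℝ → C(S1, ℝ)} (hd : Continuous d) :
    Continuous fun p : (ℝ × ℝ) × ℝ => meanSlope ux d p.1.1 p.1.2 p.2 := by
  unfold meanSlope
  apply intervalIntegral.continuous_parametric_intervalIntegral_of_continuous'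
  have h1 : Continuous fun p : ((ℝ × ℝ) × ℝ) × ℝ => d p.1.2 := hd.comp (by fun_prop)
  have h2 : Continuous fun p : ((ℝ × ℝ) × ℝ) × ℝ => (p.1.1.1 : S1) := continuous_coe_S1 (by fun_prop)
  have h3 : Continuous fun p : ((ℝ × ℝ) × ℝ) × ℝ => (p.1.1.2 : S1) := continuous_coe_S1 (by fun_prop)
  have h4 := continuous_eval_S1 h1 h2
  have h5 := continuous_eval_S1 h1 h3
  exact hux.comp ((by fun_prop : Continuous fun p : ((ℝ × ℝ) × ℝ) × ℝ => p.1.2).prodMk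
    ((continuous_shiftMap_comp h1 h2).add (continuous_coe_S1 (by fun_prop))))

theorem continuous_flowJac {ux : ℝ → S1 → ℝ} (hux : Continuous (Function.uncurry ux))
    {d : ℝ → C(S1, ℝ)} (hd : Continuous d) :
    Continuous fun p : ℝ × S1 => flowJac ux d p.1 p.2 := by
  unfold flowJac
  refine continuous_exp.comp ?_
  refine intervalIntegral.continuous_parametric_intervalIntegral_of_continuous
    (f := fun (p : ℝ × S1) (s : ℝ) => ux s (shiftMap (d s) p.2)) ?_ continuous_fst
  have h1 : Continuous fun p : (ℝ × S1) × ℝ => d p.2 := hd.comp (by fun_prop)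
  exact hux.comp ((by fun_prop : Continuous fun p : (ℝ × S1) × ℝ => p.2).prodMk
    (continuous_shiftMap_comp h1 (by fun_prop)))

/-- `d` is the displacement of the flow of the velocity field `u`, whose increments are given by
means of `ux`. -/
structure IsSlopeFlow (u ux : ℝ → S1 → ℝ) (d : ℝ → C(S1, ℝ)) : Prop where
  continuous_slope : Continuous (Function.uncurry ux)
  sub_eq : ∀ t x (r : ℝ), u t (x + r) - u t x =
    r * ∫ s in (0 : ℝ)..1, ux t (x + ((s * r : ℝ) : S1))
  initial : d 0 = 0
  continuous_disp : Continuous d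
  hasDerivAt_time : ∀ t a, HasDerivAt (fun τ => d τ a) (u t (shiftMap (d t) a)) t

/-- The distance of two trajectories satisfies a scalar linear ODE whose coefficient is the mean
slope between them. The integrating factor solves it exactly, without assuming the flow
differentiable in space. -/
theorem IsSlopeFlow.flow_sub_eq {u ux : ℝ → S1 → ℝ} {d : ℝ → C(S1, ℝ)}
    (H : IsSlopeFlow u ux d) (a a' t : ℝ) :
    (a' + d t (a' : S1)) - (a + d t (a : S1)) =
      (a' - a) * exp (∫ s in (0 : ℝ)..t, meanSlope ux d a a' s) := by
  have hQ : Continuous (meanSlope ux d a a') :=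
    (continuous_meanSlope H.continuous_slope H.continuous_disp).comp (by fun_prop : Continuous fun t : ℝ => ((a, a'), t))
  have hδ (t : ℝ) : HasDerivAt (fun t => (a' + d t (a' : S1)) - (a + d t (a : S1)))
      (((a' + d t (a' : S1)) - (a + d t (a : S1))) * meanSlope ux d a a' t) t := by
    have h1 := ((H.hasDerivAt_time t (a' : S1)).const_add a').sub
      ((H.hasDerivAt_time t (a : S1)).const_add a)
    convert! h1 using 1
    rw [meanSlope, ← H.sub_eq]
    congr 2
    rw [shiftMap_coe, shiftMap_coe, ← AddCircle.coe_add]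
    congr 1
    ring
  have hI (t : ℝ) : HasDerivAt (fun t => exp (-∫ s in (0 : ℝ)..t, meanSlope ux d a a' s))
      (exp (-∫ s in (0 : ℝ)..t, meanSlope ux d a a' s) * -meanSlope ux d a a' t) t :=
    (intervalIntegral.integral_hasDerivAt_right (hQ.intervalIntegrable _ _)
      (hQ.stronglyMeasurableAtFilter _ _) hQ.continuousAt).neg.exp
  have hc := is_const_of_deriv_eq_zero (fun t => ((hδ t).mul (hI t)).differentiableAt)
    (fun t => by
      rw [((hδ t).mul (hI t)).deriv]
      ring) t 0
  simp only [Pi.mul_apply, H.initial, intervalIntegral.integral_same, exp_zero, inv_one, mul_one,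
    ContinuousMap.zero_apply, add_zero, exp_neg] at hc
  rw [← hc, mul_assoc, inv_mul_cancel₀ (exp_pos _).ne', mul_one]

/-- The exact formula for increments, divided by `a' - a`, is continuous in `a'` and becomes the
Jacobian at `a' = a`. -/
theorem IsSlopeFlow.hasDerivAt_flow {u ux : ℝ → S1 → ℝ} {d : ℝ → C(S1, ℝ)}
    (H : IsSlopeFlow u ux d) (t a : ℝ) :
    HasDerivAt (fun r : ℝ => r + d t (r : S1)) (flowJac ux d t (a : S1)) a := by
  rw [hasDerivAt_iff_tendsto_slope]
  have hc : Continuous fun a' : ℝ => exp (∫ s in (0 : ℝ)..t, meanSlope ux d a a' s) := by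
    refine continuous_exp.comp ?_
    apply intervalIntegral.continuous_parametric_intervalIntegral_of_continuous'
    exact (continuous_meanSlope H.continuous_slope H.continuous_disp).comp
      (by fun_prop : Continuous fun p : ℝ × ℝ => ((a, p.1), p.2))
  have h1 : flowJac ux d t (a : S1) = exp (∫ s in (0 : ℝ)..t, meanSlope ux d a a s) := by
    simp [flowJac, meanSlope]
  rw [h1]
  refine (hc.tendsto a |>.mono_left nhdsWithin_le_nhds).congr' ?_
  filter_upwards [self_mem_nhdsWithin] with a' ha'
  rw [slope_def_field, H.flow_sub_eq]
  field_simp [sub_ne_zero.2 ha']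

theorem IsSlopeFlow.hasSlopeGE {u ux : ℝ → S1 → ℝ} {d : ℝ → C(S1, ℝ)}
    (H : IsSlopeFlow u ux d) {L : ℝ → ℝ} {t M : ℝ} (hL : Continuous L)
    (hb : ∀ s ∈ uIcc 0 t, ∀ x, |ux s x| ≤ L s) (hM : |∫ s in (0 : ℝ)..t, L s| ≤ M) :
    HasSlopeGE (exp (-M)) (d t) := by
  intro a a' haa'
  rw [H.flow_sub_eq, mul_comm]
  refine mul_le_mul_of_nonneg_left (exp_le_exp.2 ?_) (by linarith)
  have h1 : |∫ s in (0 : ℝ)..t, meanSlope ux d a a' s| ≤ |∫ s in (0 : ℝ)..t, L s| := by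
    have hLi : IntervalIntegrable L volume 0 t := hL.intervalIntegrable 0 t
    rw [← norm_eq_abs (∫ s in (0 : ℝ)..t, meanSlope ux d a a' s)]
    refine intervalIntegral.norm_integral_le_abs_of_norm_le ?_ hLi
    refine (ae_restrict_iff' measurableSet_uIoc).2 (Eventually.of_forall fun s hs => ?_)
    have := intervalIntegral.norm_integral_le_of_norm_le_const (a := 0) (b := 1) (C := L s)
      (f := fun r : ℝ => ux s (shiftMap (d s) (a : S1) +
        ((r * ((a' + d s (a' : S1)) - (a + d s (a : S1))) : ℝ) : S1)))
      (fun r _ => hb s (uIoc_subset_uIcc hs) _)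
    simpa [meanSlope] using this
  have := neg_le_of_abs_le (h1.trans hM)
  linarith

/-! ### Global existence of the coupled flows -/

/-- The composition of a velocity field with a circle map. -/
def velocityMap (g : S1 → ℝ) (hg : Integrable g) (e d : C(S1, ℝ)) : C(S1, ℝ) where
  toFun a := velocity g e (shiftMap d a)
  continuous_toFun := (continuous_velocity hg).comp (continuous_const.prodMk (continuous_shiftMap d))

/-- The change of evaluation point is absorbed into the generating displacement as a constant shift,
so one Lipschitz estimate covers both arguments. -/
theorem norm_velocityMap_sub_le {g : S1 → ℝ} (hg : MemLp g 2) (hgi : Integrable g) {M : ℝ}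
    (hM : 0 ≤ M) {e e' : C(S1, ℝ)} (h : HasSlopeGE (exp (-M)) e) (h' : HasSlopeGE (exp (-M)) e')
    (d d' : C(S1, ℝ)) :
    ‖velocityMap g hgi e d - velocityMap g hgi e' d'‖ ≤
      velocityBound g M * (‖e - e'‖ + ‖d - d'‖) := by
  have hB := velocityBound_nonneg g hM
  rw [ContinuousMap.norm_le _ (by positivity)]
  intro a
  have h1 (e d : C(S1, ℝ)) : velocityMap g hgi e d a =
      velocity g (e + ContinuousMap.const S1 (-(d a))) a := by
    rw [velocity_add_const]; rfl
  rw [ContinuousMap.sub_apply, h1, h1, norm_eq_abs]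
  refine (abs_velocity_sub_le hg (h'.add_const _) (h.add_const _) a).trans ?_
  gcongr
  have h2 : e + ContinuousMap.const S1 (-(d a)) - (e' + ContinuousMap.const S1 (-(d' a))) =
      (e - e') - ContinuousMap.const S1 ((d - d') a) := by
    ext b; simp; ring
  rw [h2]
  refine (norm_sub_le _ _).trans ?_
  gcongr
  rw [ContinuousMap.norm_le _ (norm_nonneg _)]
  exact fun _ => (d - d').norm_coe_le_norm a

/-- `d` is the displacement of the flow of the velocity field `v`, with Jacobian `J`. -/
structure IsFlow (v : ℝ → S1 → ℝ) (d : ℝ → C(S1, ℝ)) (J : ℝ → S1 → ℝ) : Prop where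
  initial : d 0 = 0
  continuous_disp : Continuous d
  continuous_velocity : Continuous (Function.uncurry v)
  continuous_jac : Continuous (Function.uncurry J)
  jac_pos : ∀ t a, 0 < J t a
  hasDerivAt_time : ∀ t a, HasDerivAt (fun τ => d τ a) (v t (shiftMap (d t) a)) t
  hasDerivAt_space : ∀ t (a : ℝ), HasDerivAt (fun r : ℝ => r + d t (r : S1)) (J t (a : S1)) a
  hasSlopeGE : ∀ T, ∃ M, ∀ t ∈ Icc (-T) T, HasSlopeGE (exp (-M)) (d t)

theorem continuous_velocityDeriv_comp {g : S1 → ℝ} (hg : MemLp g 2) {e : ℝ → C(S1, ℝ)}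
    (he : Continuous e) (h : ∀ T, ∃ M, ∀ t ∈ Icc (-T) T, HasSlopeGE (exp (-M)) (e t)) :
    Continuous fun p : ℝ × S1 => velocityDeriv g (e p.1) p.2 := by
  rw [continuous_iff_continuousAt]
  intro p
  obtain ⟨M, hM⟩ := h (|p.1| + 1)
  have h1 : ContinuousOn (fun p : ℝ × S1 => velocityDeriv g (e p.1) p.2)
      {q : ℝ × S1 | |q.1| < |p.1| + 1} := by
    refine (continuousOn_velocityDeriv hg M).comp
      (f := fun p : ℝ × S1 => (e p.1, p.2)) (by fun_prop) ?_
    intro q hq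
    exact hM q.1 (abs_le.1 (le_of_lt hq))
  refine h1.continuousAt (IsOpen.mem_nhds ?_ ?_)
  · exact isOpen_lt (by fun_prop) (by fun_prop)
  · simp

theorem hasDerivAt_velocity {g : S1 → ℝ} (hg : MemLp g 2) {M : ℝ} {e : C(S1, ℝ)}
    (h : HasSlopeGE (exp (-M)) e) (x : ℝ) :
    HasDerivAt (fun r : ℝ => velocity g e (r : S1)) (velocityDeriv g e (x : S1)) x := by
  have hcont : Continuous fun x => velocityDeriv g e x := by
    rw [← continuousOn_univ]
    exact (continuousOn_velocityDeriv hg M).comp (f := fun x => (e, x)) (by fun_prop)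
      fun _ _ => h
  have hc : Continuous fun y : ℝ =>
      ∫ s in (0 : ℝ)..1, velocityDeriv g e ((x : S1) + ((s * (y - x) : ℝ) : S1)) := by
    apply intervalIntegral.continuous_parametric_intervalIntegral_of_continuous'
    exact hcont.comp (continuous_const.add (continuous_coe_S1 (by fun_prop)))
  rw [hasDerivAt_iff_tendsto_slope]
  have h1 := hc.tendsto x |>.mono_left (nhdsWithin_le_nhds (s := {x}ᶜ))
  simp only [sub_self, mul_zero, AddCircle.coe_zero, add_zero,
    intervalIntegral.integral_const, sub_zero, one_smul] at h1
  refine h1.congr' ?_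
  filter_upwards [self_mem_nhdsWithin] with y hy
  have hy' : y - x ≠ 0 := sub_ne_zero.2 hy
  have h2 := velocity_coe_add_sub hg h (x : S1) (y - x)
  rw [← AddCircle.coe_add, add_sub_cancel] at h2
  rw [slope_def_field, h2, mul_div_cancel_left₀ _ hy']

theorem continuous_slopeRetract :
    Continuous fun p : ℝ × C(S1, ℝ) => slopeRetract p.1 p.2 := by
  rw [continuous_iff_continuousAt]
  intro p
  rw [ContinuousAt, tendsto_iff_norm_sub_tendsto_zero]
  refine squeeze_zero (fun _ => norm_nonneg _)
    (fun q => norm_slopeRetract_sub_le q.1 p.1 q.2 p.2) ?_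
  have h : Continuous fun q : ℝ × C(S1, ℝ) => ‖q.2 - p.2‖ + 2 * π * |q.1 - p.1| := by fun_prop
  simpa using h.tendsto p

/-- The solution of `M' = A M + B`, `M(0) = 0`, extended evenly to negative times. -/
def logSlope (A B t : ℝ) : ℝ := B / A * (exp (A * |t|) - 1)

theorem logSlope_nonneg {A B : ℝ} (hA : 0 < A) (hB : 0 ≤ B) (t : ℝ) : 0 ≤ logSlope A B t := by
  have : 1 ≤ exp (A * |t|) := one_le_exp (by positivity)
  exact mul_nonneg (by positivity) (by linarith)

theorem logSlope_mono {A B t T : ℝ} (hA : 0 < A) (hB : 0 ≤ B) (h : |t| ≤ T) :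
    logSlope A B t ≤ logSlope A B T := by
  have := h.trans (le_abs_self T)
  unfold logSlope
  gcongr

theorem continuous_logSlope (A B : ℝ) : Continuous (logSlope A B) := by
  unfold logSlope
  fun_prop

theorem abs_integral_exp_abs {A B : ℝ} (hA : 0 < A) (hB : 0 ≤ B) (t : ℝ) :
    |∫ s in (0 : ℝ)..t, B * exp (A * |s|)| = logSlope A B t := by
  have hpos (t : ℝ) (ht : 0 ≤ t) : ∫ s in (0 : ℝ)..t, B * exp (A * |s|) = logSlope A B t := by
    have h1 : ∫ s in (0 : ℝ)..t, B * exp (A * |s|) = ∫ s in (0 : ℝ)..t, B * exp (A * s) := by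
      refine intervalIntegral.integral_congr fun s hs => ?_
      rw [uIcc_of_le ht] at hs
      simp only [abs_of_nonneg hs.1]
    have h2 (s : ℝ) : HasDerivAt (fun s => B / A * exp (A * s)) (B * exp (A * s)) s := by
      have := (((hasDerivAt_id s).const_mul A).exp).const_mul (B / A)
      convert! this using 1
      simp only [id, mul_one]
      field_simp
    rw [h1, intervalIntegral.integral_eq_sub_of_hasDerivAt (fun s _ => h2 s)
      (Continuous.intervalIntegrable (by fun_prop) _ _), logSlope, abs_of_nonneg ht]
    simp
    ring
  have hn := logSlope_nonneg hA hB
  rcases le_total 0 t with ht | ht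
  · rw [hpos t ht, abs_of_nonneg (hn t)]
  · have h1 := hpos (-t) (by linarith)
    have h2 := intervalIntegral.integral_comp_neg (a := 0) (b := -t)
      (fun s => B * exp (A * |s|))
    simp only [abs_neg, neg_neg, neg_zero] at h2
    have h3 : logSlope A B (-t) = logSlope A B t := by simp [logSlope]
    rw [intervalIntegral.integral_symm, ← h2, h1, abs_neg, h3, abs_of_nonneg (hn t)]

/-- `velocityBound` is affine in `M`, and `A * logSlope A B t + B` equals `B * exp (A * |t|)`, the
forward rate of growth of `logSlope`. -/
theorem velocityBound_logSlope_le {g : S1 → ℝ} {A B : ℝ} (hA : 0 < A) (hB : 0 ≤ B)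
    (hgA : ∫ b, |g b| ≤ A) (hgB : velocityBound g 0 ≤ B) (t : ℝ) :
    velocityBound g (logSlope A B t) ≤ B * exp (A * |t|) := by
  have h1 : velocityBound g (logSlope A B t) =
      (∫ b, |g b|) * logSlope A B t + velocityBound g 0 := by
    simp only [velocityBound]; ring
  have h2 := mul_le_mul_of_nonneg_right hgA (logSlope_nonneg hA hB t)
  have h3 : A * logSlope A B t = B * exp (A * |t|) - B := by
    rw [logSlope]; field_simp
  linarith

theorem hasSlopeGE_retract_logSlope {A B : ℝ} (hA : 0 < A) (hB : 0 ≤ B) {t T : ℝ} (h : |t| ≤ T)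
    (e : C(S1, ℝ)) :
    HasSlopeGE (exp (-logSlope A B T)) (slopeRetract (exp (-logSlope A B t)) e) := by
  refine (hasSlopeGE_slopeRetract ?_ e).mono ?_
  · exact exp_le_one_iff.2 (neg_nonpos.2 (logSlope_nonneg hA hB t))
  · exact exp_le_exp.2 (neg_le_neg (logSlope_mono hA hB h))

/-- The self-consistency of the slope bound: maps with slopes at least `exp (-logSlope)` generate a
velocity with derivative at most `B * exp (A * |s|)`. Its time integral is again `logSlope`, so the
flow obeys the very bound imposed on the generating map. -/
theorem isFlow_of_retract {g : S1 → ℝ} (hg : MemLp g 2) (hgi : Integrable g) {A B : ℝ}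
    (hA : 0 < A) (hB : 0 ≤ B) (hgA : ∫ b, |g b| ≤ A) (hgB : velocityBound g 0 ≤ B)
    {d e : ℝ → C(S1, ℝ)} (hd0 : d 0 = 0) (he : Continuous e)
    (hd : ∀ t, HasDerivAt d
      (velocityMap g hgi (slopeRetract (exp (-logSlope A B t)) (e t)) (d t)) t) :
    (∀ t, HasSlopeGE (exp (-logSlope A B t)) (d t)) ∧
      ∃ J, IsFlow (fun t => velocity g (slopeRetract (exp (-logSlope A B t)) (e t))) d J := by
  set e' : ℝ → C(S1, ℝ) := fun t => slopeRetract (exp (-logSlope A B t)) (e t) with he'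
  have hc : Continuous e' :=
    continuous_slopeRetract.comp
      (((continuous_logSlope A B).neg.rexp).prodMk he)
  have hslope (t : ℝ) : HasSlopeGE (exp (-logSlope A B t)) (e' t) := by
    have := hasSlopeGE_retract_logSlope hA hB (le_refl |t|) (e t)
    rwa [show logSlope A B |t| = logSlope A B t by simp [logSlope]] at this
  have hslope' (T : ℝ) : ∃ M, ∀ t ∈ Icc (-T) T, HasSlopeGE (exp (-M)) (e' t) :=
    ⟨logSlope A B T, fun t ht => hasSlopeGE_retract_logSlope hA hB (abs_le.2 ht) (e t)⟩
  have hdc : Continuous d := continuous_iff_continuousAt.2 fun t => (hd t).continuousAt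
  have H : IsSlopeFlow (fun t => velocity g (e' t)) (fun t => velocityDeriv g (e' t)) d :=
    { continuous_slope := continuous_velocityDeriv_comp hg hc hslope'
      sub_eq := fun t x r => velocity_coe_add_sub hg (hslope t) x r
      initial := hd0
      continuous_disp := hdc
      hasDerivAt_time := fun t a =>
        (ContinuousMap.evalCLM ℝ a : C(S1, ℝ) →L[ℝ] ℝ).hasFDerivAt.comp_hasDerivAt t (hd t) }
  have hds (t : ℝ) : HasSlopeGE (exp (-logSlope A B t)) (d t) := by
    refine H.hasSlopeGE (L := fun s => B * exp (A * |s|)) (by fun_prop) (fun s _ x => ?_)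
      (abs_integral_exp_abs hA hB t).le
    exact (abs_velocityDeriv_le hg (hslope s) x).trans
      (velocityBound_logSlope_le hA hB hgA hgB s)
  refine ⟨hds, flowJac (fun t => velocityDeriv g (e' t)) d,
    { initial := hd0
      continuous_disp := hdc
      continuous_velocity := (continuous_velocity hgi).comp
        ((hc.comp continuous_fst).prodMk continuous_snd)
      continuous_jac := continuous_flowJac H.continuous_slope hdc
      jac_pos := fun t a => exp_pos _
      hasDerivAt_time := H.hasDerivAt_time
      hasDerivAt_space := H.hasDerivAt_flow
      hasSlopeGE := fun T => ⟨logSlope A B T, fun t ht => (hds t).mono ?_⟩ }⟩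
  exact exp_le_exp.2 (neg_le_neg (logSlope_mono hA hB (abs_le.2 ht)))

/-- Global existence of the coupled flows generated by two pushed forward densities. -/
theorem exists_coupled_flow {g h : S1 → ℝ} (hg : MemLp g 2) (hh : MemLp h 2) :
    ∃ (d e : ℝ → C(S1, ℝ)) (J J' : ℝ → S1 → ℝ),
      IsFlow (fun t => velocity h (e t)) d J ∧ IsFlow (fun t => velocity g (d t)) e J' := by
  have hgi : Integrable g := hg.integrable (by norm_num)
  have hhi : Integrable h := hh.integrable (by norm_num)
  have hg0 : 0 ≤ ∫ b, |g b| := integral_nonneg fun _ => abs_nonneg _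
  have hh0 : 0 ≤ ∫ b, |h b| := integral_nonneg fun _ => abs_nonneg _
  have hgB := velocityBound_nonneg g le_rfl
  have hhB := velocityBound_nonneg h le_rfl
  -- One pair of constants serves both equations; the summand 1 keeps `A` positive, as `logSlope`
  -- divides by it.
  obtain ⟨A, hA⟩ : ∃ A, A = (∫ b, |g b|) + (∫ b, |h b|) + 1 := ⟨_, rfl⟩
  obtain ⟨B, hB⟩ : ∃ B, B = velocityBound g 0 + velocityBound h 0 := ⟨_, rfl⟩
  have hA0 : 0 < A := by linarith
  have hB0 : 0 ≤ B := by linarith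
  obtain ⟨Cg, hCg0, hCg⟩ := exists_abs_velocity_le hgi
  obtain ⟨Ch, hCh0, hCh⟩ := exists_abs_velocity_le hhi
  set R : ℝ → C(S1, ℝ) → C(S1, ℝ) := fun t => slopeRetract (exp (-logSlope A B t)) with hR
  obtain ⟨α, hα0, hα⟩ := exists_global_hasDerivAt
    (fun t (p : C(S1, ℝ) × C(S1, ℝ)) =>
      (velocityMap h hhi (R t p.2) p.1, velocityMap g hgi (R t p.1) p.2)) 0
    (C := max Ch Cg) (le_max_of_le_left hCh0)
    (fun t p => max_le_max
      ((ContinuousMap.norm_le _ hCh0).2 fun a => hCh _ _)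
      ((ContinuousMap.norm_le _ hCg0).2 fun a => hCg _ _))
    (fun p => by
      have key (k : S1 → ℝ) (hk : Integrable k) (e d : C(S1, ℝ)) :
          Continuous fun t => velocityMap k hk (R t e) d := by
        refine ContinuousMap.continuous_of_continuous_uncurry _ ?_
        have h1 : Continuous fun q : ℝ × S1 => R q.1 e :=
          continuous_slopeRetract.comp
            (((continuous_logSlope A B).comp continuous_fst).neg.rexp.prodMk continuous_const)
        exact (continuous_velocity hk).comp
          (h1.prodMk ((continuous_shiftMap d).comp continuous_snd))
      exact (key h hhi p.2 p.1).prodMk (key g hgi p.1 p.2))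
    (fun T => by
      have key (k : S1 → ℝ) (hk : MemLp k 2) (hki : Integrable k) (t : ℝ) (ht : t ∈ Icc (-T) T)
          (e e' d d' : C(S1, ℝ)) : ‖velocityMap k hki (R t e) d - velocityMap k hki (R t e') d'‖ ≤
            velocityBound k (logSlope A B T) * (‖e - e'‖ + ‖d - d'‖) := by
        have hM := logSlope_nonneg hA0 hB0 T
        refine (norm_velocityMap_sub_le hk hki hM
          (hasSlopeGE_retract_logSlope hA0 hB0 (abs_le.2 ht) e)
          (hasSlopeGE_retract_logSlope hA0 hB0 (abs_le.2 ht) e') d d').trans ?_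
        have := velocityBound_nonneg k hM
        gcongr
        simpa using norm_slopeRetract_sub_le (exp (-logSlope A B t)) (exp (-logSlope A B t)) e e'
      have hM := logSlope_nonneg hA0 hB0 T
      have h1 := velocityBound_nonneg g hM
      have h2 := velocityBound_nonneg h hM
      refine ⟨⟨2 * (velocityBound g (logSlope A B T) + velocityBound h (logSlope A B T)),
        by positivity⟩, fun t ht => LipschitzWith.of_dist_le_mul fun p q => ?_⟩
      rw [dist_eq_norm, dist_eq_norm]
      have h3 : ‖p.1 - q.1‖ ≤ ‖p - q‖ := norm_fst_le (p - q)
      have h4 : ‖p.2 - q.2‖ ≤ ‖p - q‖ := norm_snd_le (p - q)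
      refine max_le ?_ ?_
      · refine (key h hh hhi t ht p.2 q.2 p.1 q.1).trans ?_
        change _ ≤ 2 * (velocityBound g (logSlope A B T) + velocityBound h (logSlope A B T)) *
          ‖p - q‖
        nlinarith [norm_nonneg (p - q), mul_nonneg h1 (norm_nonneg (p - q)),
          mul_le_mul_of_nonneg_left (add_le_add h4 h3) h2]
      · refine (key g hg hgi t ht p.1 q.1 p.2 q.2).trans ?_
        change _ ≤ 2 * (velocityBound g (logSlope A B T) + velocityBound h (logSlope A B T)) *
          ‖p - q‖
        nlinarith [norm_nonneg (p - q), mul_nonneg h2 (norm_nonneg (p - q)),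
          mul_le_mul_of_nonneg_left (add_le_add h3 h4) h1])
  have hαc : Continuous α := continuous_iff_continuousAt.2 fun t => (hα t).continuousAt
  obtain ⟨hd, J, hJ⟩ := isFlow_of_retract hh hhi hA0 hB0 (by linarith) (by linarith)
    (d := fun t => (α t).1) (e := fun t => (α t).2) (by rw [hα0]; rfl) (by fun_prop)
    (fun t => (hα t).fst)
  obtain ⟨he, J', hJ'⟩ := isFlow_of_retract hg hgi hA0 hB0 (by linarith) (by linarith)
    (d := fun t => (α t).2) (e := fun t => (α t).1) (by rw [hα0]; rfl) (by fun_prop)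
    (fun t => (hα t).snd)
  -- Both displacements already satisfy the slope bound, so the retraction fixes them and the
  -- original coupled equations remain.
  simp only [fun t => (he t).slopeRetract_eq] at hJ
  simp only [fun t => (hd t).slopeRetract_eq] at hJ'
  exact ⟨_, _, J, J', hJ, hJ'⟩

/-! ### Transport of `L²` densities by a flow -/

/-- The class in `L²` of a continuous function. -/
def toL2 : C(S1, ℝ) →L[ℝ] L2S1 := ContinuousMap.toLp 2 volume ℝ

theorem coeFn_toL2 (φ : C(S1, ℝ)) : toL2 φ =ᵐ[volume] φ := ContinuousMap.coeFn_toLp _ _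

theorem dense_toL2 : DenseRange toL2 := ContinuousMap.toLp_denseRange _ _ _ (by norm_num)

/-- Multiplication of an `L²` function by a continuous function. -/
def mulL2 : C(S1, ℝ) →L[ℝ] L2S1 →L[ℝ] L2S1 :=
  ((ContinuousLinearMap.mul ℝ ℝ).holderL volume ⊤ 2 2).comp (ContinuousMap.toLp ⊤ volume ℝ)

theorem coeFn_mulL2 (φ : C(S1, ℝ)) (f : L2S1) : mulL2 φ f =ᵐ[volume] fun x => φ x * f x := by
  have h1 := (ContinuousLinearMap.mul ℝ ℝ).coeFn_holder (r := 2)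
    (ContinuousMap.toLp ⊤ (volume : Measure S1) ℝ φ) f
  have h2 := ContinuousMap.coeFn_toLp (p := ⊤) (𝕜 := ℝ) (volume : Measure S1) φ
  filter_upwards [h1, h2] with x h1 h2
  rw [h2] at h1
  exact h1

theorem inner_L2S1 (f g : L2S1) : inner ℝ f g = ∫ x, g x * f x := by
  rw [L2.inner_def]
  rfl

theorem inner_toL2 (φ : C(S1, ℝ)) (f : L2S1) : inner ℝ (toL2 φ) f = ∫ x, f x * φ x := by
  rw [inner_L2S1]
  refine integral_congr_ae ?_
  filter_upwards [coeFn_toL2 φ] with x hx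
  rw [hx]

theorem norm_sq_L2S1 (f : L2S1) : ‖f‖ ^ 2 = ∫ x, f x ^ 2 := by
  rw [← real_inner_self_eq_norm_sq, inner_L2S1]
  simp only [sq]

namespace IsFlow

variable {v : ℝ → S1 → ℝ} {d : ℝ → C(S1, ℝ)} {J : ℝ → S1 → ℝ}

theorem strictMono (H : IsFlow v d J) (t : ℝ) :
    StrictMono fun r : ℝ => r + d t (r : S1) :=
  strictMono_of_hasDerivAt_pos (fun r => H.hasDerivAt_space t r) (fun r => H.jac_pos t r)

theorem injective (H : IsFlow v d J) (t : ℝ) : Function.Injective (shiftMap (d t)) := by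
  obtain ⟨M, hM⟩ := H.hasSlopeGE |t|
  intro a b hab
  have h := (hM t (abs_le.1 le_rfl)).mul_norm_le (exp_pos _).le a b
  rw [hab, sub_self, norm_zero] at h
  have h2 : ‖a - b‖ ≤ 0 := nonpos_of_mul_nonpos_right h (exp_pos _)
  exact sub_eq_zero.1 (norm_le_zero_iff.1 h2)

/-- The flow map at time `t`. -/
def homeo (H : IsFlow v d J) (t : ℝ) : S1 ≃ₜ S1 :=
  Continuous.homeoOfEquivCompactToT2
    (f := Equiv.ofBijective (shiftMap (d t)) ⟨H.injective t, shiftMap_surjective (d t)⟩)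
    (continuous_shiftMap (d t))

theorem homeo_apply (H : IsFlow v d J) (t : ℝ) (b : S1) : H.homeo t b = shiftMap (d t) b := rfl

/-- With `b₀` the preimage of `x₀` at time `t₀`, the preimage of `x` at time `t` is within `exp M *
‖x - X(t, b₀)‖` of `b₀`, with `M` uniform for `t` near `t₀`. -/
theorem continuous_homeo_symm (H : IsFlow v d J) :
    Continuous fun p : ℝ × S1 => (H.homeo p.1).symm p.2 := by
  rw [continuous_iff_continuousAt]
  rintro ⟨t₀, x₀⟩
  obtain ⟨M, hM⟩ := H.hasSlopeGE (|t₀| + 1)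
  rw [ContinuousAt, tendsto_iff_norm_sub_tendsto_zero]
  have hc : Continuous fun p : ℝ × S1 =>
      exp M * ‖p.2 - shiftMap (d p.1) ((H.homeo t₀).symm x₀)‖ :=
    continuous_const.mul (continuous_snd.sub (continuous_shiftMap_comp
      (H.continuous_disp.comp continuous_fst) continuous_const)).norm
  have h1 := hc.tendsto (t₀, x₀)
  have h2 : shiftMap (d t₀) ((H.homeo t₀).symm x₀) = x₀ := (H.homeo t₀).apply_symm_apply x₀
  simp only [h2, sub_self, norm_zero, mul_zero] at h1
  refine squeeze_zero' (Eventually.of_forall fun _ => norm_nonneg _) ?_ h1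
  have hev : ∀ᶠ p : ℝ × S1 in 𝓝 (t₀, x₀), |p.1| < |t₀| + 1 :=
    (continuous_abs.comp continuous_fst).continuousAt.eventually_lt_const (by simp)
  filter_upwards [hev] with p hp
  have h3 := (hM p.1 (abs_le.1 hp.le)).mul_norm_le (exp_pos _).le
    ((H.homeo p.1).symm p.2) ((H.homeo t₀).symm x₀)
  rw [← H.homeo_apply p.1, Homeomorph.apply_symm_apply, exp_neg] at h3
  rwa [inv_mul_le_iff₀ (exp_pos _)] at h3

theorem continuous_jac_apply (H : IsFlow v d J) (t : ℝ) : Continuous (J t) :=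
  H.continuous_jac.comp (by fun_prop : Continuous fun b : S1 => (t, b))

/-- Change of variables on the lift, which maps a period interval onto a period interval. -/
theorem lintegral_jac_mul (H : IsFlow v d J) (t : ℝ) (f : S1 → ENNReal) :
    ∫⁻ b, ENNReal.ofReal (J t b) * f (shiftMap (d t) b) = ∫⁻ x, f x := by
  set φ : ℝ → ℝ := fun r => r + d t (r : S1) with hφ
  have hmono := H.strictMono t
  have hper : φ (0 + 2 * π) = φ 0 + 2 * π := by
    simp only [hφ, AddCircle.coe_add_period]
    ring
  have hcont : Continuous φ := continuous_iff_continuousAt.2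
    fun r => (H.hasDerivAt_space t r).continuousAt
  have himg : φ '' Ioc 0 (0 + 2 * π) = Ioc (φ 0) (φ 0 + 2 * π) := by
    rw [← hper]
    apply Subset.antisymm
    · rintro _ ⟨r, hr, rfl⟩
      exact ⟨hmono hr.1, hmono.monotone hr.2⟩
    · intro y hy
      obtain ⟨r, hr, rfl⟩ := intermediate_value_Icc (by linarith [two_pi_pos] : (0 : ℝ) ≤ 0 + 2 * π)
        hcont.continuousOn ⟨hy.1.le, hy.2⟩
      exact ⟨r, ⟨hmono.lt_iff_lt.1 hy.1, hr.2⟩, rfl⟩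
  rw [← AddCircle.lintegral_preimage (2 * π) (φ 0) f, ← himg,
    lintegral_image_eq_lintegral_abs_deriv_mul measurableSet_Ioc
      (fun r _ => (H.hasDerivAt_space t r).hasDerivWithinAt) hmono.injective.injOn,
    ← AddCircle.lintegral_preimage (2 * π) 0]
  refine lintegral_congr fun r => ?_
  rw [shiftMap_coe, abs_of_pos (H.jac_pos t r)]

/-- The Jacobian as a nonnegative density. -/
def density (J : ℝ → S1 → ℝ) (t : ℝ) (b : S1) : NNReal := (J t b).toNNReal

theorem measurable_density (H : IsFlow v d J) (t : ℝ) : Measurable (density J t) :=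
  (H.continuous_jac_apply t).measurable.real_toNNReal

theorem measurePreserving_homeo (H : IsFlow v d J) (t : ℝ) :
    MeasurePreserving (H.homeo t) (volume.withDensity fun b => density J t b) volume := by
  refine ⟨(H.homeo t).measurable, ?_⟩
  ext s hs
  rw [Measure.map_apply (H.homeo t).measurable hs, withDensity_apply _ ((H.homeo t).measurable hs),
    ← lintegral_indicator_one hs, ← H.lintegral_jac_mul t,
    ← lintegral_indicator ((H.homeo t).measurable hs)]
  refine lintegral_congr fun b => ?_
  by_cases hb : shiftMap (d t) b ∈ s
  · rw [indicator_of_mem (by exact hb), indicator_of_mem hb, Pi.one_apply, mul_one]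
    rfl
  · rw [indicator_of_notMem (by exact hb), indicator_of_notMem hb, mul_zero]

theorem measurePreserving_symm (H : IsFlow v d J) (t : ℝ) :
    MeasurePreserving (H.homeo t).symm volume (volume.withDensity fun b => density J t b) :=
  MeasurePreserving.symm (H.homeo t).toMeasurableEquiv (H.measurePreserving_homeo t)

theorem integral_comp_symm (H : IsFlow v d J) (t : ℝ) (F : S1 → ℝ) :
    ∫ x, F ((H.homeo t).symm x) = ∫ b, J t b * F b := by
  have h := (H.measurePreserving_symm t).integral_comp
    (H.homeo t).symm.measurableEmbedding F
  rw [h, integral_withDensity_eq_integral_smul (H.measurable_density t)]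
  refine integral_congr_ae (Eventually.of_forall fun b => ?_)
  simp only [NNReal.smul_def, smul_eq_mul, density, Real.coe_toNNReal _ (H.jac_pos t b).le]

theorem quasiMeasurePreserving_symm (H : IsFlow v d J) (t : ℝ) :
    Measure.QuasiMeasurePreserving (H.homeo t).symm volume volume :=
  (H.measurePreserving_symm t).quasiMeasurePreserving.mono_right
    (withDensity_absolutelyContinuous _ _)

theorem integrable_comp_symm (H : IsFlow v d J) (t : ℝ) {F : S1 → ℝ} (hF : Integrable F) :
    Integrable fun x => F ((H.homeo t).symm x) := by
  have h := (H.measurePreserving_symm t).integrable_comp_emb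
    (H.homeo t).symm.measurableEmbedding (g := F)
  rw [Function.comp_def] at h
  rw [h, integrable_withDensity_iff_integrable_smul (H.measurable_density t)]
  refine (integrable_continuous_mul hF (H.continuous_jac_apply t)).congr
    (Eventually.of_forall fun b => ?_)
  simp only [NNReal.smul_def, smul_eq_mul, density, Real.coe_toNNReal _ (H.jac_pos t b).le]

/-- The density at time `t` of the measure `g db` transported by the flow. -/
def push (H : IsFlow v d J) (t : ℝ) (g : S1 → ℝ) (x : S1) : ℝ :=
  g ((H.homeo t).symm x) * (J t ((H.homeo t).symm x))⁻¹

theorem continuous_inv_jac (H : IsFlow v d J) (t : ℝ) : Continuous fun b => (J t b)⁻¹ :=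
  (H.continuous_jac_apply t).inv₀ fun b => (H.jac_pos t b).ne'

theorem integral_push_mul (H : IsFlow v d J) (t : ℝ) (g φ : S1 → ℝ) :
    ∫ x, H.push t g x * φ x = ∫ b, g b * φ (shiftMap (d t) b) := by
  have h := H.integral_comp_symm t
    (fun b => g b * (J t b)⁻¹ * φ (shiftMap (d t) b))
  have h2 : (fun b => J t b * (g b * (J t b)⁻¹ * φ (shiftMap (d t) b))) =
      fun b => g b * φ (shiftMap (d t) b) := by
    funext b
    have := (H.jac_pos t b).ne'
    field_simp
  rw [h2] at h
  rw [← h]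
  refine integral_congr_ae (Eventually.of_forall fun x => ?_)
  simp only [push, ← H.homeo_apply, Homeomorph.apply_symm_apply]

theorem integral_push_sq (H : IsFlow v d J) (t : ℝ) (g : S1 → ℝ) :
    ∫ x, H.push t g x ^ 2 = ∫ b, g b ^ 2 * (J t b)⁻¹ := by
  have h := H.integral_comp_symm t (fun b => (g b * (J t b)⁻¹) ^ 2)
  simp only [push, h]
  refine integral_congr_ae (Eventually.of_forall fun b => ?_)
  have := (H.jac_pos t b).ne'
  field_simp

theorem memLp_push (H : IsFlow v d J) (t : ℝ) {g : S1 → ℝ} (hg : MemLp g 2) :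
    MemLp (H.push t g) 2 := by
  have hm : AEStronglyMeasurable (H.push t g) volume :=
    (hg.aestronglyMeasurable.mul
      (H.continuous_inv_jac t).aestronglyMeasurable).comp_quasiMeasurePreserving
      (H.quasiMeasurePreserving_symm t)
  rw [memLp_two_iff_integrable_sq hm]
  have h := integrable_mul_continuous hg.integrable_sq ((H.continuous_inv_jac t).pow 2)
  refine (H.integrable_comp_symm t h).congr (Eventually.of_forall fun x => ?_)
  simp only [push, mul_pow, Pi.pow_apply]

theorem push_congr_ae (H : IsFlow v d J) (t : ℝ) {g g' : S1 → ℝ} (h : g =ᵐ[volume] g') :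
    H.push t g =ᵐ[volume] H.push t g' := by
  filter_upwards [(H.quasiMeasurePreserving_symm t).ae h] with x hx
  rw [push, push, hx]

/-- The transport of an `L²` density by the flow. -/
def pushL2 (H : IsFlow v d J) (t : ℝ) (g : L2S1) : L2S1 := (H.memLp_push t (Lp.memLp g)).toLp

theorem coeFn_pushL2 (H : IsFlow v d J) (t : ℝ) (g : L2S1) :
    H.pushL2 t g =ᵐ[volume] H.push t g := MemLp.coeFn_toLp _

theorem pushL2_sub (H : IsFlow v d J) (t : ℝ) (g g' : L2S1) :
    H.pushL2 t (g - g') = H.pushL2 t g - H.pushL2 t g' := by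
  apply Lp.ext
  filter_upwards [H.coeFn_pushL2 t g, H.coeFn_pushL2 t g', H.coeFn_pushL2 t (g - g'),
    Lp.coeFn_sub (H.pushL2 t g) (H.pushL2 t g'),
    H.push_congr_ae t (Lp.coeFn_sub g g')] with x h1 h2 h3 h4 h5
  rw [h3, h4, h5, Pi.sub_apply, h1, h2, push, push, push, Pi.sub_apply, sub_mul]

theorem norm_pushL2_sq (H : IsFlow v d J) (t : ℝ) (g : L2S1) :
    ‖H.pushL2 t g‖ ^ 2 = ∫ b, g b ^ 2 * (J t b)⁻¹ := by
  rw [norm_sq_L2S1, ← H.integral_push_sq]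
  refine integral_congr_ae ?_
  filter_upwards [H.coeFn_pushL2 t g] with x hx
  rw [hx]

theorem exists_norm_pushL2_le (H : IsFlow v d J) (T : ℝ) :
    ∃ C, 0 < C ∧ ∀ t ∈ Icc (-T) T, ∀ g, ‖H.pushL2 t g‖ ≤ C * ‖g‖ := by
  have hc : Continuous fun p : ℝ × S1 => (J p.1 p.2)⁻¹ :=
    H.continuous_jac.inv₀ fun p => (H.jac_pos p.1 p.2).ne'
  -- `C` is not known to be positive, and for negative `T` the time interval is empty; hence the
  -- maximum with 1 below.
  obtain ⟨C, hC⟩ := ((isCompact_Icc (a := -T) (b := T)).prod (isCompact_univ (X := S1))).bddAbove_image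
    hc.continuousOn
  refine ⟨√(max C 1), sqrt_pos.2 (by positivity), fun t ht g => ?_⟩
  refine abs_le_of_sq_le_sq' ?_ (by positivity) |>.2
  rw [H.norm_pushL2_sq, mul_pow, sq_sqrt (by positivity), norm_sq_L2S1, ← integral_const_mul]
  refine integral_mono (integrable_mul_continuous (Lp.memLp g).integrable_sq
    (H.continuous_inv_jac t)) ((Lp.memLp g).integrable_sq.const_mul _) fun b => ?_
  simp only
  rw [mul_comm]
  gcongr
  exact (hC ⟨(t, b), ⟨ht, mem_univ _⟩, rfl⟩).trans (le_max_left _ _)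

theorem continuous_pushL2_toL2 (H : IsFlow v d J) (φ : C(S1, ℝ)) :
    Continuous fun t => H.pushL2 t (toL2 φ) := by
  have hc : Continuous fun p : ℝ × S1 => H.push p.1 φ p.2 := by
    have h1 : Continuous fun p : ℝ × S1 => J p.1 ((H.homeo p.1).symm p.2) :=
      H.continuous_jac.comp (continuous_fst.prodMk H.continuous_homeo_symm)
    exact (φ.continuous.comp H.continuous_homeo_symm).mul (h1.inv₀ fun p => (H.jac_pos _ _).ne')
  set Φ : C(ℝ, C(S1, ℝ)) := ContinuousMap.curry ⟨_, hc⟩ with hΦ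
  refine (toL2.continuous.comp Φ.continuous).congr fun t => ?_
  apply Lp.ext
  filter_upwards [coeFn_toL2 (Φ t), H.coeFn_pushL2 t (toL2 φ),
    H.push_congr_ae t (coeFn_toL2 φ)] with x h1 h2 h3
  rw [h2, h3]
  exact h1

/-- For continuous densities the transported function is jointly continuous. The transport operators
are bounded uniformly on compact time intervals, so the general case is a locally uniform limit. -/
theorem continuous_pushL2 (H : IsFlow v d J) (g : L2S1) : Continuous fun t => H.pushL2 t g := by
  rw [continuous_iff_continuousAt]
  intro t₀
  obtain ⟨C, hC0, hC⟩ := H.exists_norm_pushL2_le (|t₀| + 1)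
  have h : ContinuousOn (fun t => H.pushL2 t g) (Ioo (-(|t₀| + 1)) (|t₀| + 1)) := by
    refine continuousOn_of_uniform_approx_of_continuousOn fun u hu => ?_
    obtain ⟨ε, hε, hεu⟩ := Metric.mem_uniformity_dist.1 hu
    obtain ⟨φ, hφ⟩ := dense_toL2.exists_dist_lt g (ε := ε / C) (by positivity)
    refine ⟨fun t => H.pushL2 t (toL2 φ), (H.continuous_pushL2_toL2 φ).continuousOn,
      fun t ht => hεu ?_⟩
    rw [dist_eq_norm, ← H.pushL2_sub]
    refine (hC t (Ioo_subset_Icc_self ht) _).trans_lt ?_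
    rw [dist_eq_norm] at hφ
    rwa [← lt_div_iff₀' hC0]
  exact h.continuousAt (isOpen_Ioo.mem_nhds (abs_lt.1 (by linarith)))

end IsFlow

/-! ### Transport of `H¹` functions and the evolution equation -/

namespace IsFlow

variable {v : ℝ → S1 → ℝ} {d : ℝ → C(S1, ℝ)} {J : ℝ → S1 → ℝ}

/-- The transport of a continuous function by the flow. -/
def transportFn (H : IsFlow v d J) (F : C(S1, ℝ)) : C(ℝ, C(S1, ℝ)) :=
  ContinuousMap.curry ⟨fun p : ℝ × S1 => F ((H.homeo p.1).symm p.2),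
    F.continuous.comp H.continuous_homeo_symm⟩

theorem transportFn_apply (H : IsFlow v d J) (F : C(S1, ℝ)) (t : ℝ) (x : S1) :
    H.transportFn F t x = F ((H.homeo t).symm x) := rfl

theorem integral_transportFn_mul (H : IsFlow v d J) (F : C(S1, ℝ)) (t : ℝ) (φ : S1 → ℝ) :
    ∫ x, H.transportFn F t x * φ x = ∫ b, F b * (φ (shiftMap (d t) b) * J t b) := by
  have h := H.integral_comp_symm t (fun b => F b * φ (shiftMap (d t) b))
  rw [show (fun b => F b * (φ (shiftMap (d t) b) * J t b)) =
    fun b => J t b * (F b * φ (shiftMap (d t) b)) by funext b; ring, ← h]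
  refine integral_congr_ae (Eventually.of_forall fun x => ?_)
  simp only [transportFn_apply, ← H.homeo_apply, Homeomorph.apply_symm_apply]

theorem integral_pushL2_mul (H : IsFlow v d J) (t : ℝ) (g : L2S1) (φ : S1 → ℝ) :
    ∫ x, H.pushL2 t g x * φ x = ∫ b, g b * φ (shiftMap (d t) b) := by
  rw [← H.integral_push_mul]
  refine integral_congr_ae ?_
  filter_upwards [H.coeFn_pushL2 t g] with x hx
  rw [hx]

/-- In particle coordinates the test function becomes `φ ∘ X` with derivative `(ψ ∘ X) J`, and the
claim is integration by parts against `F` there. -/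
theorem isWeakDeriv_transport (H : IsFlow v d J) {F : C(S1, ℝ)} {g : L2S1}
    (hF : IsPrimitive F g) (t : ℝ) :
    IsWeakDeriv (toL2 (H.transportFn F t)) (H.pushL2 t g) := by
  intro φ ψ h
  have hc : Continuous fun b => ψ (shiftMap (d t) b) * J t b :=
    (h.continuous_snd.comp (continuous_shiftMap (d t))).mul (H.continuous_jac_apply t)
  have hprim : IsPrimitive (fun b => φ (shiftMap (d t) b))
      (fun b => ψ (shiftMap (d t) b) * J t b) := by
    refine isPrimitive_of_hasDerivAt hc fun r => ?_
    have := (h.deriv (r + d t (r : S1))).comp r (H.hasDerivAt_space t r)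
    simp only [shiftMap_coe]
    exact this
  rw [H.integral_pushL2_mul, ← hF.integral_mul_eq hprim (integrable_L2S1 g) hc.integrable_S1,
    ← H.integral_transportFn_mul]
  refine integral_congr_ae ?_
  filter_upwards [coeFn_toL2 (H.transportFn F t)] with x hx
  rw [hx]

/-- The transport of an `H¹` function by the flow. -/
def transport (H : IsFlow v d J) {F : C(S1, ℝ)} {g : L2S1} (hF : IsPrimitive F g) (t : ℝ) : H1S1 :=
  ⟨WithLp.toLp 2 (toL2 (H.transportFn F t), H.pushL2 t g), H.isWeakDeriv_transport hF t⟩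

theorem transport_fn (H : IsFlow v d J) {F : C(S1, ℝ)} {g : L2S1} (hF : IsPrimitive F g) (t : ℝ) :
    (H.transport hF t).fn = toL2 (H.transportFn F t) := rfl

theorem transport_dx (H : IsFlow v d J) {F : C(S1, ℝ)} {g : L2S1} (hF : IsPrimitive F g) (t : ℝ) :
    (H.transport hF t).dx = H.pushL2 t g := rfl

theorem continuous_transport (H : IsFlow v d J) {F : C(S1, ℝ)} {g : L2S1} (hF : IsPrimitive F g) :
    Continuous (H.transport hF) := by
  refine Continuous.subtype_mk ?_ _
  exact (WithLp.prod_continuous_toLp 2 L2S1 L2S1).comp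
    ((toL2.continuous.comp (H.transportFn F).continuous).prodMk (H.continuous_pushL2 g))

/-- The velocity field as a curve of continuous functions. -/
def velocityCurve (H : IsFlow v d J) : C(ℝ, C(S1, ℝ)) :=
  ContinuousMap.curry ⟨Function.uncurry v, H.continuous_velocity⟩

theorem velocityCurve_apply (H : IsFlow v d J) (t : ℝ) (x : S1) : H.velocityCurve t x = v t x := rfl

theorem continuous_mulL2_pushL2 (H : IsFlow v d J) (g : L2S1) :
    Continuous fun t => mulL2 (H.velocityCurve t) (H.pushL2 t g) :=
  (mulL2.continuous.comp H.velocityCurve.continuous).clm_apply (H.continuous_pushL2 g)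

/-- The equation integrated in time against `φ`, without differentiating the Jacobian in time. For a
primitive `Φ` of `φ` on the line, `Φ(X_t) - Φ` is periodic although `Φ` need not be. It equals the
time integral of `φ(X_s) v(s, X_s)`, while its space derivative is `φ(X_t) J_t - φ`; integrating by
parts against `F` links the two. -/
theorem integral_jac_sub_eq (H : IsFlow v d J) {F : C(S1, ℝ)} {g : L2S1} (hF : IsPrimitive F g)
    (φ : C(S1, ℝ)) (t : ℝ) :
    (∫ b, F b * (φ (shiftMap (d t) b) * J t b)) - ∫ b, F b * φ b =
      -∫ s in (0 : ℝ)..t, ∫ b, g b * (φ (shiftMap (d s) b) * v s (shiftMap (d s) b)) := by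
  have hX : Continuous fun p : ℝ × S1 => shiftMap (d p.1) p.2 :=
    continuous_shiftMap_comp (H.continuous_disp.comp continuous_fst) continuous_snd
  set ζ : C(ℝ, C(S1, ℝ)) := ContinuousMap.curry
    ⟨fun p : ℝ × S1 => φ (shiftMap (d p.1) p.2) * v p.1 (shiftMap (d p.1) p.2),
      (φ.continuous.comp hX).mul (H.continuous_velocity.comp (continuous_fst.prodMk hX))⟩ with hζ
  have hζi : IntervalIntegrable ζ volume 0 t := ζ.continuous.intervalIntegrable _ _
  set W : C(S1, ℝ) := ∫ s in (0 : ℝ)..t, ζ s with hW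
  have hWb (b : S1) : W b = ∫ s in (0 : ℝ)..t, ζ s b :=
    ((ContinuousMap.evalCLM ℝ b : C(S1, ℝ) →L[ℝ] ℝ).intervalIntegral_comp_comm hζi).symm
  set Φ : ℝ → ℝ := fun y => ∫ u in (0 : ℝ)..y, φ (u : S1) with hΦ
  have hφc : Continuous fun u : ℝ => φ (u : S1) := φ.continuous.comp (continuous_coe_S1 continuous_id)
  have hΦd (y : ℝ) : HasDerivAt Φ (φ (y : S1)) y :=
    intervalIntegral.integral_hasDerivAt_right (hφc.intervalIntegrable _ _)
      (hφc.stronglyMeasurableAtFilter _ _) hφc.continuousAt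
  have hWr (r : ℝ) : W (r : S1) = Φ (r + d t (r : S1)) - Φ r := by
    have h1 (s : ℝ) : HasDerivAt (fun s => Φ (r + d s (r : S1))) (ζ s (r : S1)) s := by
      have := (hΦd (r + d s (r : S1))).comp s ((H.hasDerivAt_time s (r : S1)).const_add r)
      rw [← shiftMap_coe] at this
      exact this
    have h2 : Continuous fun s => ζ s (r : S1) := by fun_prop
    rw [hWb, intervalIntegral.integral_eq_sub_of_hasDerivAt (fun s _ => h1 s)
      (h2.intervalIntegrable _ _), H.initial, ContinuousMap.zero_apply, add_zero]
  have hc1 : Continuous fun b => φ (shiftMap (d t) b) * J t b :=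
    (φ.continuous.comp (continuous_shiftMap (d t))).mul (H.continuous_jac_apply t)
  have hprim : IsPrimitive W (fun b => φ (shiftMap (d t) b) * J t b - φ b) := by
    refine isPrimitive_of_hasDerivAt (hc1.sub φ.continuous) fun r => ?_
    have := ((hΦd (r + d t (r : S1))).comp r (H.hasDerivAt_space t r)).sub (hΦd r)
    simp only [hWr, shiftMap_coe]
    exact this
  have hgi := integrable_L2S1 g
  have hFi := hF.continuous hgi
  have h3 := hF.integral_mul_eq hprim hgi (hc1.sub φ.continuous).integrable_S1
  simp only [mul_sub] at h3
  have h5 : Integrable fun b => F b * (φ (shiftMap (d t) b) * J t b) := (hFi.mul hc1).integrable_S1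
  have h6 : Integrable fun b => F b * φ b := (hFi.mul φ.continuous).integrable_S1
  rw [integral_sub h5 h6] at h3
  have h4 (ψ : C(S1, ℝ)) : ((innerSL ℝ g).comp toL2) ψ = ∫ b, g b * ψ b := by
    rw [ContinuousLinearMap.comp_apply, innerSL_apply_apply, real_inner_comm, inner_toL2]
  rw [h3, ← h4, ← ((innerSL ℝ g).comp toL2).intervalIntegral_comp_comm hζi]
  simp only [h4]
  rfl

/-- The identity tested against continuous functions becomes an identity in `L²` by density. Its
integrand is continuous in time, which yields the `C¹` regularity. -/
theorem transport_fn_sub_eq (H : IsFlow v d J) {F : C(S1, ℝ)} {g : L2S1} (hF : IsPrimitive F g)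
    (t : ℝ) :
    (H.transport hF t).fn = (H.transport hF 0).fn -
      ∫ s in (0 : ℝ)..t, mulL2 (H.velocityCurve s) (H.pushL2 s g) := by
  have hZ := H.continuous_mulL2_pushL2 g
  have key (φ : C(S1, ℝ)) (t : ℝ) : inner ℝ (toL2 φ) (H.transport hF t).fn =
      (∫ b, F b * φ b) -
        ∫ s in (0 : ℝ)..t, inner ℝ (toL2 φ) (mulL2 (H.velocityCurve s) (H.pushL2 s g)) := by
    have h1 (s : ℝ) : inner ℝ (toL2 φ) (mulL2 (H.velocityCurve s) (H.pushL2 s g)) =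
        ∫ b, g b * (φ (shiftMap (d s) b) * v s (shiftMap (d s) b)) := by
      rw [inner_toL2, ← H.integral_pushL2_mul s g (fun x => φ x * v s x)]
      refine integral_congr_ae ?_
      filter_upwards [coeFn_mulL2 (H.velocityCurve s) (H.pushL2 s g)] with x hx
      rw [hx, velocityCurve_apply]
      ring
    have h2 := H.integral_jac_sub_eq hF φ t
    have h3 : inner ℝ (toL2 φ) (H.transport hF t).fn =
        ∫ b, F b * (φ (shiftMap (d t) b) * J t b) := by
      rw [inner_toL2, ← H.integral_transportFn_mul, transport_fn]
      refine integral_congr_ae ?_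
      filter_upwards [coeFn_toL2 (H.transportFn F t)] with x hx
      rw [hx]
    simp only [h1]
    rw [h3]
    linarith
  refine dense_toL2.eq_of_inner_right ℝ fun φ => ?_
  have h1 := (innerSL ℝ (toL2 φ)).intervalIntegral_comp_comm (hZ.intervalIntegrable (μ := volume) 0 t)
  simp only [innerSL_apply_apply] at h1
  rw [inner_sub_right, key, key, ← h1, intervalIntegral.integral_same, sub_zero]

theorem hasDerivAt_transport_fn (H : IsFlow v d J) {F : C(S1, ℝ)} {g : L2S1}
    (hF : IsPrimitive F g) (t : ℝ) :
    HasDerivAt (fun t => (H.transport hF t).fn)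
      (-mulL2 (H.velocityCurve t) (H.pushL2 t g)) t := by
  have hZ := H.continuous_mulL2_pushL2 g
  have h := (intervalIntegral.integral_hasDerivAt_right (hZ.intervalIntegrable 0 t)
    (hZ.stronglyMeasurableAtFilter _ _) hZ.continuousAt).const_sub (H.transport hF 0).fn
  refine h.congr_of_eventuallyEq (Eventually.of_forall fun s => ?_)
  exact H.transport_fn_sub_eq hF s

end IsFlow

/-! ### Existence -/

theorem H1S1.ext_fn {u w : H1S1} (h : u.fn = w.fn) : u = w := by
  have h2 : u.dx = w.dx := by
    have hu : IsWeakDeriv u.fn u.dx := u.2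
    have hw : IsWeakDeriv w.fn w.dx := w.2
    rw [← h] at hw
    exact hu.unique hw
  apply Subtype.ext
  apply (WithLp.equiv 2 (L2S1 × L2S1)).injective
  exact Prod.ext h h2

theorem IsFlow.transport_zero {v : ℝ → S1 → ℝ} {d : ℝ → C(S1, ℝ)} {J : ℝ → S1 → ℝ}
    (H : IsFlow v d J) {u : H1S1} {F : C(S1, ℝ)} (hF : IsPrimitive F u.dx)
    (hu : F =ᵐ[volume] u.fn) : H.transport hF 0 = u := by
  apply H1S1.ext_fn
  rw [H.transport_fn]
  apply Lp.ext
  have h (x : S1) : (H.homeo 0).symm x = x := by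
    rw [Homeomorph.symm_apply_eq, H.homeo_apply, shiftMap, H.initial, ContinuousMap.zero_apply,
      AddCircle.coe_zero, add_zero]
  filter_upwards [coeFn_toL2 (H.transportFn F 0), hu] with x h1 h2
  rw [h1, H.transportFn_apply, h, h2]

/-- By Fubini and translation invariance every particle contributes the same integral of
`kernelPrim`, and the total weight is zero. -/
theorem integral_velocity {g : S1 → ℝ} (hg : Integrable g) (h0 : ∫ b, g b = 0) (e : C(S1, ℝ)) :
    ∫ x, velocity g e x = 0 := by
  have hc : Continuous fun p : S1 × S1 => kernelPrim (p.1 - shiftMap e p.2) :=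
    continuous_kernelPrim.comp (continuous_fst.sub ((continuous_shiftMap e).comp continuous_snd))
  obtain ⟨C, hC⟩ : BddAbove (range fun x => ‖kernelPrim x‖) :=
    (isCompact_range continuous_kernelPrim.norm).bddAbove
  have hi : Integrable (fun p : S1 × S1 => kernelPrim (p.1 - shiftMap e p.2) * g p.2)
      (volume.prod volume) :=
    (hg.comp_snd volume).bdd_mul (c := C) hc.aestronglyMeasurable
      (Eventually.of_forall fun p => hC ⟨_, rfl⟩)
  simp only [velocity]
  rw [integral_integral_swap hi]
  simp only [integral_mul_const,
    fun b => integral_sub_right_eq_self (μ := (volume : Measure S1)) kernelPrim (shiftMap e b)]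
  rw [integral_const_mul, h0, mul_zero]

theorem continuous_velocityDeriv {g : S1 → ℝ} (hg : MemLp g 2) {M : ℝ} {e : C(S1, ℝ)}
    (h : HasSlopeGE (exp (-M)) e) : Continuous (velocityDeriv g e) := by
  rw [← continuousOn_univ]
  exact (continuousOn_velocityDeriv hg M).comp (f := fun x => (e, x)) (by fun_prop) fun _ _ => h

/-- The velocity field generated by a pushed forward density, as a continuous function. -/
def velocityCM {g : S1 → ℝ} (hg : MemLp g 2) (e : C(S1, ℝ)) : C(S1, ℝ) :=
  ⟨velocity g e, (continuous_velocity (hg.integrable (by norm_num))).comp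
    (by fun_prop : Continuous fun x : S1 => (e, x))⟩

theorem isPrimitive_velocity {g : S1 → ℝ} (hg : MemLp g 2) {M : ℝ} {e : C(S1, ℝ)}
    (h : HasSlopeGE (exp (-M)) e) : IsPrimitive (velocity g e) (velocityDeriv g e) :=
  isPrimitive_of_hasDerivAt (continuous_velocityDeriv hg h) fun s => hasDerivAt_velocity hg h s

/-- The velocity field generated by a pushed forward density, as an `H¹` function. -/
def velocityH1 {g : S1 → ℝ} (hg : MemLp g 2) {M : ℝ} {e : C(S1, ℝ)}
    (h : HasSlopeGE (exp (-M)) e) : H1S1 :=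
  ⟨WithLp.toLp 2 (toL2 (velocityCM hg e), toL2 ⟨_, continuous_velocityDeriv hg h⟩),
    isWeakDeriv_of_isPrimitive ((isPrimitive_velocity hg h).congr_ae
      (coeFn_toL2 ⟨_, continuous_velocityDeriv hg h⟩).symm) (coeFn_toL2 (velocityCM hg e)).symm⟩

theorem velocityH1_fn {g : S1 → ℝ} (hg : MemLp g 2) {M : ℝ} {e : C(S1, ℝ)}
    (h : HasSlopeGE (exp (-M)) e) : (velocityH1 hg h).fn =ᵐ[volume] velocity g e :=
  coeFn_toL2 (velocityCM hg e)

theorem velocityH1_dx {g : S1 → ℝ} (hg : MemLp g 2) {M : ℝ} {e : C(S1, ℝ)}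
    (h : HasSlopeGE (exp (-M)) e) : (velocityH1 hg h).dx =ᵐ[volume] velocityDeriv g e :=
  coeFn_toL2 ⟨_, continuous_velocityDeriv hg h⟩

theorem H1S1.hasHilbertTransformAt (w : H1S1) (x : S1) :
    HasHilbertTransformAt w.fn x (∫ y, logKernel (x - y) * w.dx y) := by
  obtain ⟨F, hF, hw⟩ := IsWeakDeriv.exists_isPrimitive w.2
  exact (hasHilbertTransformAt_of_isPrimitive hF (Lp.memLp _) x).congr_ae hw

/-- The density of the transported function is the pushforward of `g`, so convolving it with the
kernel is the same as integrating over particles, which is `velocityDeriv`. -/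
theorem IsFlow.isVelocityOf {v : ℝ → S1 → ℝ} {d : ℝ → C(S1, ℝ)} {J : ℝ → S1 → ℝ}
    (H : IsFlow v d J) {F : C(S1, ℝ)} {g : L2S1} (hF : IsPrimitive F g) (t : ℝ) {M : ℝ}
    (h : HasSlopeGE (exp (-M)) (d t)) :
    IsVelocityOf (velocityH1 (Lp.memLp g) h) (H.transport hF t) := by
  constructor
  · filter_upwards [velocityH1_dx (Lp.memLp g) h] with x hx
    have h1 := (H.transport hF t).hasHilbertTransformAt x
    have h2 := H.integral_pushL2_mul t g (fun y => logKernel (x - y))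
    simp only [mul_comm _ (logKernel _)] at h2
    rw [H.transport_dx, h2] at h1
    rw [hx]
    exact h1
  · rw [integral_congr_ae (velocityH1_fn (Lp.memLp g) h)]
    exact integral_velocity (integrable_L2S1 g) hF.integral_eq_zero _

theorem IsFlow.contDiff_transport_fn {v : ℝ → S1 → ℝ} {d : ℝ → C(S1, ℝ)} {J : ℝ → S1 → ℝ}
    (H : IsFlow v d J) {F : C(S1, ℝ)} {g : L2S1} (hF : IsPrimitive F g) :
    ContDiff ℝ 1 fun t => (H.transport hF t).fn := by
  rw [contDiff_one_iff_deriv]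
  refine ⟨fun t => (H.hasDerivAt_transport_fn hF t).differentiableAt, ?_⟩
  rw [show deriv (fun t => (H.transport hF t).fn) =
    fun t => -mulL2 (H.velocityCurve t) (H.pushL2 t g) from
      funext fun t => (H.hasDerivAt_transport_fn hF t).deriv]
  exact (H.continuous_mulL2_pushL2 g).neg

theorem IsFlow.transport_equation {v : ℝ → S1 → ℝ} {d : ℝ → C(S1, ℝ)} {J : ℝ → S1 → ℝ}
    (H : IsFlow v d J) {F : C(S1, ℝ)} {g : L2S1} (hF : IsPrimitive F g) {t : ℝ}
    (ht : t ∈ Ici (0 : ℝ)) {m : L2S1} (hm : m =ᵐ[volume] v t) :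
    ∀ᵐ x : S1, derivWithin (fun τ => (H.transport hF τ).fn) (Ici 0) t x +
      m x * (H.transport hF t).dx x = 0 := by
  rw [(H.hasDerivAt_transport_fn hF t).hasDerivWithinAt.derivWithin (uniqueDiffOn_Ici 0 t ht)]
  filter_upwards [hm, Lp.coeFn_neg (mulL2 (H.velocityCurve t) (H.pushL2 t g)),
    coeFn_mulL2 (H.velocityCurve t) (H.pushL2 t g)] with x h1 h2 h3
  rw [h2, Pi.neg_apply, h3, h1, H.velocityCurve_apply, H.transport_dx]
  ring

theorem exists_isGlobalSolution (Ω₀ ω₀ : H1S1) : ∃ Ω ω : ℝ → H1S1, IsGlobalSolution Ω₀ ω₀ Ω ω := by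
  obtain ⟨F, hF, hFΩ⟩ := IsWeakDeriv.exists_isPrimitive Ω₀.2
  obtain ⟨G, hG, hGω⟩ := IsWeakDeriv.exists_isPrimitive ω₀.2
  lift F to C(S1, ℝ) using hF.continuous (integrable_L2S1 _)
  lift G to C(S1, ℝ) using hG.continuous (integrable_L2S1 _)
  obtain ⟨d, e, J, J', HX, HY⟩ := exists_coupled_flow (Lp.memLp Ω₀.dx) (Lp.memLp ω₀.dx)
  refine ⟨HX.transport hF, HY.transport hG,
    { continuousOn_Ω := (HX.continuous_transport hF).continuousOn
      continuousOn_ω := (HY.continuous_transport hG).continuousOn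
      contDiffOn_Ω := (HX.contDiff_transport_fn hF).contDiffOn
      contDiffOn_ω := (HY.contDiff_transport_fn hG).contDiffOn
      initial_Ω := HX.transport_zero hF hFΩ
      initial_ω := HY.transport_zero hG hGω
      equations := fun t ht => ?_ }⟩
  obtain ⟨M, hM⟩ := HX.hasSlopeGE |t|
  obtain ⟨M', hM'⟩ := HY.hasSlopeGE |t|
  have h1 := hM t (abs_le.1 le_rfl)
  have h2 := hM' t (abs_le.1 le_rfl)
  exact ⟨_, _, HX.isVelocityOf hF t h1, HY.isVelocityOf hG t h2,
    HX.transport_equation hF ht (velocityH1_fn _ h2),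
    HY.transport_equation hG ht (velocityH1_fn _ h1)⟩

/-! ### Velocities as convolutions with an `L²` kernel -/

/-- The translated and reflected kernel `y ↦ K(x - y)` in `L²`. -/
def kernelL2 (x : S1) : L2S1 := (memLp_logKernel_sub x).toLp

theorem inner_kernelL2 (x : S1) (f : L2S1) :
    inner ℝ (kernelL2 x) f = ∫ y, logKernel (x - y) * f y := by
  rw [inner_L2S1]
  refine integral_congr_ae ?_
  filter_upwards [(memLp_logKernel_sub x).coeFn_toLp] with y hy
  rw [kernelL2, hy, mul_comm]

theorem norm_kernelL2 (x : S1) : ‖kernelL2 x‖ = √(∫ z, logKernel z ^ 2) := by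
  rw [← sqrt_sq (norm_nonneg (kernelL2 x)), norm_sq_L2S1,
    ← integral_sub_left_eq_self (fun z => logKernel z ^ 2) volume x]
  congr 1
  refine integral_congr_ae ?_
  filter_upwards [(memLp_logKernel_sub x).coeFn_toLp] with y hy
  rw [kernelL2, hy]

theorem abs_inner_kernelL2_le (x : S1) (f : L2S1) :
    |inner ℝ (kernelL2 x) f| ≤ √(∫ z, logKernel z ^ 2) * ‖f‖ := by
  rw [← norm_kernelL2 x]
  exact abs_real_inner_le_norm _ _

theorem isPrimitive_kernelPrim_sub (x : S1) :
    IsPrimitive (fun y => kernelPrim (x - y)) (fun y => -logKernel (x - y)) := by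
  obtain ⟨ξ, rfl, -⟩ := exists_rep x
  intro a b
  simp only [← AddCircle.coe_sub]
  rw [isPrimitive_kernelPrim, intervalIntegral.integral_neg,
    intervalIntegral.integral_comp_sub_left (fun s : ℝ => logKernel (s : S1)) ξ,
    intervalIntegral.integral_symm]

theorem shiftMap_zero (b : S1) : shiftMap 0 b = b := by
  rw [shiftMap, ContinuousMap.zero_apply, AddCircle.coe_zero, add_zero]

theorem hasSlopeGE_zero : HasSlopeGE (exp (-0)) 0 := by
  intro a b _
  simp

theorem velocityDeriv_zero (f : L2S1) (x : S1) :
    velocityDeriv f 0 x = inner ℝ (kernelL2 x) f := by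
  simp only [velocityDeriv, shiftMap_zero, inner_kernelL2]

/-- Integration by parts moves the derivative from `w` to the kernel, so the velocity is controlled
by the `L²` norm of `w` alone; the uniqueness estimate rests on this. -/
theorem velocity_dx_zero (w : H1S1) (x : S1) :
    velocity w.dx 0 x = inner ℝ (kernelL2 x) w.fn := by
  obtain ⟨F, hF, hFw⟩ := IsWeakDeriv.exists_isPrimitive w.2
  have h := (isPrimitive_kernelPrim_sub x).integral_mul_eq hF
    ((memLp_logKernel_sub x).integrable (by norm_num)).neg (integrable_L2S1 _)
  simp only [neg_mul, integral_neg, neg_neg] at h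
  simp only [velocity, shiftMap_zero, inner_kernelL2]
  refine h.trans (integral_congr_ae ?_)
  filter_upwards [hFw] with y hy
  rw [hy]
  rfl

theorem IsVelocityOf.dx_eq {p w : H1S1} (h : IsVelocityOf p w) :
    ∀ᵐ x, p.dx x = inner ℝ (kernelL2 x) w.dx := by
  filter_upwards [h.1] with x hx
  rw [inner_kernelL2]
  exact tendsto_nhds_unique hx (w.hasHilbertTransformAt x)

/-- The Hilbert transform determines `p` up to a constant, and the zero mean fixes that constant. -/
theorem IsVelocityOf.fn_eq {p w : H1S1} (h : IsVelocityOf p w) :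
    ∀ᵐ x, p.fn x = inner ℝ (kernelL2 x) w.fn := by
  obtain ⟨P, hP, hPp⟩ := IsWeakDeriv.exists_isPrimitive p.2
  obtain ⟨W, hW, -⟩ := IsWeakDeriv.exists_isPrimitive w.2
  have hV := isPrimitive_velocity (Lp.memLp w.dx) hasSlopeGE_zero
  have hdx : velocityDeriv w.dx 0 =ᵐ[volume] p.dx := by
    filter_upwards [h.dx_eq] with x hx
    rw [hx, velocityDeriv_zero]
  have hV' := hV.congr_ae hdx
  set c := P 0 - velocity w.dx 0 0 with hc
  have hPV (x : S1) : P x = velocity w.dx 0 x + c := by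
    obtain ⟨ξ, rfl, -⟩ := exists_rep x
    have h1 := hP 0 ξ
    have h2 := hV' 0 ξ
    rw [AddCircle.coe_zero] at h1 h2
    change P ξ - P 0 = ∫ s in (0 : ℝ)..ξ, p.dx (s : S1) at h1
    rw [← h2] at h1
    linarith
  have hVc : Continuous (velocity w.dx 0) := hV'.continuous (integrable_L2S1 _)
  have hc0 : c = 0 := by
    have h1 : ∫ x, P x = 0 := by
      rw [← h.2]
      exact integral_congr_ae hPp
    simp only [hPV] at h1
    rw [integral_add hVc.integrable_S1 (integrable_const c),
      integral_velocity (integrable_L2S1 w.dx) hW.integral_eq_zero, integral_const,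
      volume_real_S1, zero_add, smul_eq_mul] at h1
    exact (mul_eq_zero.1 h1).resolve_left two_pi_pos.ne'
  filter_upwards [hPp] with x hx
  change P x = p.fn x at hx
  rw [← hx, hPV, hc0, add_zero, velocity_dx_zero]

/-! ### Energy estimate and uniqueness -/

/-- The differential energy inequality for the difference of two solutions of transport equations
with different velocities. -/
theorem inner_sub_le_of_transport {w w' m m' : H1S1} {D D' : L2S1} {B b : ℝ} (hb : 0 ≤ b)
    (hD : ∀ᵐ x, D x + m.fn x * w.dx x = 0) (hD' : ∀ᵐ x, D' x + m'.fn x * w'.dx x = 0)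
    (hB : ∀ᵐ x, |m.dx x| ≤ B) (hmm' : ∀ᵐ x, |m.fn x - m'.fn x| ≤ b) :
    2 * inner ℝ (w.fn - w'.fn) (D - D') ≤
      B * ‖w.fn - w'.fn‖ ^ 2 + 2 * (b * (‖w'.dx‖ * ‖w.fn - w'.fn‖)) := by
  obtain ⟨U, hU, hUw⟩ := IsWeakDeriv.exists_isPrimitive (w - w').2
  obtain ⟨P, hP, hPm⟩ := IsWeakDeriv.exists_isPrimitive m.2
  have hUi := integrable_L2S1 (w - w').dx
  have hUc := hU.continuous hUi
  set u : L2S1 := w.fn - w'.fn with hu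
  have hUu : U =ᵐ[volume] u := hUw
  have hux : (w - w').dx =ᵐ[volume] fun x => w.dx x - w'.dx x := Lp.coeFn_sub w.dx w'.dx
  have hU2i : Integrable fun x => (w - w').dx x * U x + U x * (w - w').dx x :=
    (integrable_mul_continuous hUi hUc).add (integrable_continuous_mul hUi hUc)
  -- Integrating `U²` against the derivative of `m` replaces `-2 ∫ m u u_x` by `∫ m_x u²`, so no
  -- derivative of the difference `u` remains.
  have hparts := (hU.mul hU hUi hUi).integral_mul_eq hP hU2i (integrable_L2S1 m.dx)
  have hPc := hP.continuous (integrable_L2S1 m.dx)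
  have hI1 : Integrable fun x => ((w - w').dx x * U x + U x * (w - w').dx x) * P x :=
    integrable_mul_continuous hU2i hPc
  have hI2 : Integrable fun x => 2 * ((m.fn x - m'.fn x) * (w'.dx x * u x)) := by
    refine Integrable.const_mul ?_ 2
    have h1 : Integrable fun x => w'.dx x * u x := (Lp.memLp w'.dx).integrable_mul (Lp.memLp u)
    exact h1.bdd_mul (c := b)
      ((Lp.aestronglyMeasurable m.fn).sub (Lp.aestronglyMeasurable m'.fn)) hmm'
  have hI1n : Integrable fun x => -(((w - w').dx x * U x + U x * (w - w').dx x) * P x) := hI1.neg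
  -- The splitting is `m w_x - m' w'_x = m (w - w')_x + (m - m') w'_x`.
  have heq : 2 * inner ℝ u (D - D') =
      -(∫ x, ((w - w').dx x * U x + U x * (w - w').dx x) * P x) -
        ∫ x, 2 * ((m.fn x - m'.fn x) * (w'.dx x * u x)) := by
    rw [← integral_neg, ← integral_sub hI1n hI2, inner_L2S1, ← integral_const_mul]
    refine integral_congr_ae ?_
    filter_upwards [hD, hD', hUu, hPm, hux, Lp.coeFn_sub D D'] with x h1 h2 h3 h4 h5 h6
    change P x = m.fn x at h4
    rw [h6, Pi.sub_apply, h3, h4, h5]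
    have h7 : D x = -(m.fn x * w.dx x) := by linarith
    have h8 : D' x = -(m'.fn x * w'.dx x) := by linarith
    rw [h7, h8]
    ring
  have hmain1 : -(∫ x, ((w - w').dx x * U x + U x * (w - w').dx x) * P x) ≤ B * ‖u‖ ^ 2 := by
    change ∫ x, U x * U x * m.dx x =
      -∫ x, ((w - w').dx x * U x + U x * (w - w').dx x) * P x at hparts
    rw [← hparts, norm_sq_L2S1, ← integral_const_mul]
    refine integral_mono_ae (integrable_continuous_mul (integrable_L2S1 m.dx) (hUc.mul hUc))
      ((Lp.memLp u).integrable_sq.const_mul B) ?_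
    filter_upwards [hUu, hB] with x h1 h2
    rw [h1]
    nlinarith [le_of_abs_le h2, mul_self_nonneg (u x)]
  have hmain2 : -(∫ x, 2 * ((m.fn x - m'.fn x) * (w'.dx x * u x))) ≤
      2 * (b * (‖w'.dx‖ * ‖u‖)) := by
    have habs : ∫ x, |w'.dx x| * |u x| ≤ ‖w'.dx‖ * ‖u‖ := by
      have h1 := real_inner_le_norm (|u|) (|w'.dx|)
      rw [norm_abs_eq_norm, norm_abs_eq_norm, mul_comm ‖u‖ ‖w'.dx‖, inner_L2S1] at h1
      refine le_trans (le_of_eq (integral_congr_ae ?_)) h1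
      filter_upwards [Lp.coeFn_abs u, Lp.coeFn_abs w'.dx] with x h2 h3
      rw [h2, h3]
    have h2 : Integrable fun x => |w'.dx x| * |u x| :=
      (Lp.memLp w'.dx).abs.integrable_mul (Lp.memLp u).abs
    calc _ ≤ ∫ x, 2 * (b * (|w'.dx x| * |u x|)) := by
          rw [← integral_neg]
          refine integral_mono_ae hI2.neg ((h2.const_mul b).const_mul 2) ?_
          filter_upwards [hmm'] with x hx
          rw [← abs_mul]
          have h3 := neg_abs_le ((m.fn x - m'.fn x) * (w'.dx x * u x))
          have h4 := mul_le_mul_of_nonneg_right hx (abs_nonneg (w'.dx x * u x))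
          rw [abs_mul] at h3
          linarith
      _ = 2 * (b * ∫ x, |w'.dx x| * |u x|) := by rw [integral_const_mul, integral_const_mul]
      _ ≤ _ := by gcongr
  linarith

theorem H1S1.continuous_dx : Continuous H1S1.dx :=
  continuous_snd.comp ((WithLp.prod_continuous_ofLp 2 L2S1 L2S1).comp continuous_subtype_val)

theorem H1S1.exists_norm_dx_le {u : ℝ → H1S1} (hu : ContinuousOn u (Ici 0)) (T : ℝ) :
    ∃ N, ∀ t ∈ Icc 0 T, ‖(u t).dx‖ ≤ N :=
  isCompact_Icc.exists_bound_of_continuousOn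
    ((H1S1.continuous_dx.comp_continuousOn hu).mono Icc_subset_Ici_self)

/-- The differential inequality for one of the two unknowns. -/
theorem inner_sub_le_of_isVelocityOf {w w' q q' m m' : H1S1} {D D' : L2S1} {κ N : ℝ}
    (hκ : κ = √(∫ z, logKernel z ^ 2)) (hN : ‖q.dx‖ ≤ N) (hN' : ‖w'.dx‖ ≤ N)
    (hm : IsVelocityOf m q) (hm' : IsVelocityOf m' q')
    (hD : ∀ᵐ x, D x + m.fn x * w.dx x = 0) (hD' : ∀ᵐ x, D' x + m'.fn x * w'.dx x = 0) :
    2 * inner ℝ (w.fn - w'.fn) (D - D') ≤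
      κ * N * (‖w.fn - w'.fn‖ ^ 2 + 2 * (‖q.fn - q'.fn‖ * ‖w.fn - w'.fn‖)) := by
  have hκ0 : 0 ≤ κ := hκ ▸ sqrt_nonneg _
  have hN0 : 0 ≤ N := (norm_nonneg _).trans hN
  have h := inner_sub_le_of_transport (B := κ * N) (b := κ * ‖q.fn - q'.fn‖) (by positivity)
    hD hD' (by
      filter_upwards [hm.dx_eq] with x hx
      rw [hx, hκ]
      exact (abs_inner_kernelL2_le x _).trans (by gcongr)) (by
      filter_upwards [hm.fn_eq, hm'.fn_eq] with x hx hx'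
      rw [hx, hx', ← inner_sub_right, hκ]
      exact abs_inner_kernelL2_le x _)
  refine h.trans ?_
  have h1 : κ * ‖q.fn - q'.fn‖ * (‖w'.dx‖ * ‖w.fn - w'.fn‖) ≤
      κ * ‖q.fn - q'.fn‖ * (N * ‖w.fn - w'.fn‖) := by gcongr
  linarith

/-- Gronwall for the sum of the squared `L²` distances. On `[0, T]` the `L²` norms of the space
derivatives are bounded, by continuity into `H¹` and compactness. -/
theorem isGlobalSolution_unique {Ω₀ ω₀ : H1S1} {Ω ω Ω' ω' : ℝ → H1S1}
    (h : IsGlobalSolution Ω₀ ω₀ Ω ω) (h' : IsGlobalSolution Ω₀ ω₀ Ω' ω') {T : ℝ} (hT : 0 ≤ T) :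
    Ω T = Ω' T ∧ ω T = ω' T := by
  obtain ⟨N₁, hN₁⟩ := H1S1.exists_norm_dx_le h.continuousOn_Ω T
  obtain ⟨N₂, hN₂⟩ := H1S1.exists_norm_dx_le h.continuousOn_ω T
  obtain ⟨N₃, hN₃⟩ := H1S1.exists_norm_dx_le h'.continuousOn_Ω T
  obtain ⟨N₄, hN₄⟩ := H1S1.exists_norm_dx_le h'.continuousOn_ω T
  obtain ⟨N, hN1, hN2, hN3, hN4⟩ : ∃ N, N₁ ≤ N ∧ N₂ ≤ N ∧ N₃ ≤ N ∧ N₄ ≤ N :=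
    ⟨max (max N₁ N₂) (max N₃ N₄), by simp, by simp, by simp, by simp⟩
  obtain ⟨κ, hκ⟩ : ∃ κ, κ = √(∫ z, logKernel z ^ 2) := ⟨_, rfl⟩
  have hκ0 : 0 ≤ κ := hκ ▸ sqrt_nonneg _
  have hN0 : 0 ≤ N := (norm_nonneg _).trans ((hN₁ 0 ⟨le_rfl, hT⟩).trans hN1)
  set E : ℝ → ℝ := fun t =>
    ‖(Ω t).fn - (Ω' t).fn‖ ^ 2 + ‖(ω t).fn - (ω' t).fn‖ ^ 2 with hE
  have hd {u : ℝ → H1S1} (hu : ContDiffOn ℝ 1 (fun t => (u t).fn) (Ici 0)) {t : ℝ}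
      (ht : t ∈ Ici (0 : ℝ)) : HasDerivWithinAt (fun t => (u t).fn)
        (derivWithin (fun t => (u t).fn) (Ici 0) t) (Ici 0) t :=
    (hu.differentiableOn one_ne_zero t ht).hasDerivWithinAt
  have hderiv : ∀ t ∈ Icc 0 T, ∃ E', HasDerivWithinAt E E' (Ici 0) t ∧ E' ≤ 3 * (κ * N) * E t := by
    intro t ht
    have ht0 : t ∈ Ici (0 : ℝ) := ht.1
    obtain ⟨p, m, hp, hm, e1, e2⟩ := h.equations t ht0
    obtain ⟨p', m', hp', hm', e1', e2'⟩ := h'.equations t ht0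
    have hΩ := ((hd h.contDiffOn_Ω ht0).sub (hd h'.contDiffOn_Ω ht0)).norm_sq
    have hω := ((hd h.contDiffOn_ω ht0).sub (hd h'.contDiffOn_ω ht0)).norm_sq
    refine ⟨_, hΩ.add hω, ?_⟩
    have k1 := inner_sub_le_of_isVelocityOf hκ ((hN₂ t ht).trans hN2) ((hN₃ t ht).trans hN3)
      hm hm' e1 e1'
    have k2 := inner_sub_le_of_isVelocityOf hκ ((hN₁ t ht).trans hN1) ((hN₄ t ht).trans hN4)
      hp hp' e2 e2'
    have hκN : 0 ≤ κ * N := by positivity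
    -- The cross terms add up to four times the product of the two distances, at most twice the
    -- energy; together with the diagonal terms this gives the factor 3.
    have k3 := mul_nonneg hκN
      (sq_nonneg (‖(Ω t).fn - (Ω' t).fn‖ - ‖(ω t).fn - (ω' t).fn‖))
    simp only [Pi.sub_apply, hE]
    nlinarith
  set K := 3 * (κ * N) with hK
  have hexp (t : ℝ) : HasDerivAt (fun t => exp (-K * t)) (exp (-K * t) * -K) t := by
    simpa using ((hasDerivAt_id t).const_mul (-K)).exp
  have hanti : AntitoneOn (fun t => E t * exp (-K * t)) (Icc 0 T) := by
    refine antitoneOn_of_deriv_nonpos (convex_Icc 0 T) ?_ ?_ ?_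
    · intro t ht
      obtain ⟨E', hE', -⟩ := hderiv t ht
      exact (hE'.continuousWithinAt.mono Icc_subset_Ici_self).mul
        (hexp t).continuousAt.continuousWithinAt
    · intro t ht
      rw [interior_Icc] at ht
      obtain ⟨E', hE', -⟩ := hderiv t (Ioo_subset_Icc_self ht)
      exact ((hE'.hasDerivAt (Ici_mem_nhds ht.1)).mul
        (hexp t)).differentiableAt.differentiableWithinAt
    · intro t ht
      rw [interior_Icc] at ht
      obtain ⟨E', hE', hle⟩ := hderiv t (Ioo_subset_Icc_self ht)
      have h1 := ((hE'.hasDerivAt (Ici_mem_nhds ht.1)).mul (hexp t)).deriv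
      change deriv (E * fun t => exp (-K * t)) t ≤ 0
      rw [h1]
      nlinarith [exp_pos (-K * t)]
  have h0 : E 0 = 0 := by
    simp only [hE, h.initial_Ω, h'.initial_Ω, h.initial_ω, h'.initial_ω, sub_self, norm_zero]
    norm_num
  have hET : E T ≤ 0 := by
    have h1 := hanti ⟨le_rfl, hT⟩ ⟨hT, le_rfl⟩ hT
    simp only [h0, zero_mul] at h1
    exact nonpos_of_mul_nonpos_left h1 (exp_pos _)
  have h1 := sq_nonneg ‖(Ω T).fn - (Ω' T).fn‖
  have h2 := sq_nonneg ‖(ω T).fn - (ω' T).fn‖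
  simp only [hE] at hET
  constructor
  · refine H1S1.ext_fn (sub_eq_zero.1 (norm_eq_zero.1 (pow_eq_zero_iff two_ne_zero |>.1 ?_)))
    linarith
  · refine H1S1.ext_fn (sub_eq_zero.1 (norm_eq_zero.1 (pow_eq_zero_iff two_ne_zero |>.1 ?_)))
    linarith

end

theorem mainTheorem4 (Ω₀ ω₀ : H1S1) :
    (∃ Ω ω : ℝ → H1S1, IsGlobalSolution Ω₀ ω₀ Ω ω) ∧
      ∀ Ω ω Ω' ω' : ℝ → H1S1, IsGlobalSolution Ω₀ ω₀ Ω ω → IsGlobalSolution Ω₀ ω₀ Ω' ω' →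
        ∀ t : ℝ, 0 ≤ t → Ω t = Ω' t ∧ ω t = ω' t :=
  ⟨exists_isGlobalSolution Ω₀ ω₀, fun _ _ _ _ h h' _ ht => isGlobalSolution_unique h h' ht⟩
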